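/- Let $(\xi_n)_{n\ge 1}$ be independent random variables, each uniformly distributed on $[0,1]$, and let $T_n$ be the binary search tree generated from $\xi_1,\dots,\xi_n$: the values are stored one after the other, each one moving from the root to the left if it is smaller than the label of the current node and to the right otherwise, until it finds an empty node, where it is stored. We regard $T_n$ as a finite set of words over $\{0,1\}$, where $0$ means left, $1$ means right, and the root is the empty word. For a binary tree $T$ and $s\in[0,1]$ with binary expansion $s=\sum_{k\ge1}u_k2^{-k}$ (with $u_k=0$ eventually if $s<1$ is a binary rational, and $u_k=1$ for all $k$ if $s=1$), let $$X_s(T)=\min\{k\ge 0:(u_1,\dots,u_k)\notin T\},\qquad Y_t(T)=\int_0^t X_s(T)\,ds ,$$ $$Y^\circ_t(T)=Y_t(T)-t\,Y_1(T)\quad(0\le t\le1),\qquad \eta^\circ(T)=Y_1(T)-H_{\#T},\qquad H_n=\sum_{k=1}^n \frac1k .$$ Let $C_{00}[0,1]$ be the space of continuous $f:[0,1]\to\mathbb R$ with $f(0)=f(1)=0$, with the supremum norm, and let $Z_n=(Y^\circ(T_n),\eta^\circ(T_n))$, a random element of $C_{00}[0,1]\times\mathbb R$. As $n\to\infty$,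 $Z_n$ converges in distribution in $C_{00}[0,1]\times\mathbb R$ to a random element $Z_\infty=(Y_\infty,\zeta)$, and every such limit $Z_\infty=(Y_\infty,\zeta)$ satisfies $$P\left(\sup_{0\le s<t\le1}\frac{|Y_\infty(t)-Y_\infty(s)|}{|t-s|}=\infty\right)=1$$ and, for all real $\alpha<1$, $$P\left(\sup_{0\le s<t\le1}\frac{|Y_\infty(t)-Y_\infty(s)|}{|t-s|^\alpha}<\infty\right)=1 .$$ -/

import Mathlib

open MeasureTheory ProbabilityTheory Filter Topology
open scoped unitInterval ENNReal

noncomputable section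

namespace Silhouette

/-! ### Binary trees, given by their set of (internal) nodes

A node is a finite word over `{0, 1}` (`false = 0 =` left, `true = 1 =` right); the root is `[]`.
A binary tree is a finite prefix-stable set of nodes; the functionals below are written for any
finite set of nodes and are applied to trees only. -/

/-- The `(i+1)`-st digit (`i = 0, 1, …`) in the binary expansion of `s ∈ [0, 1]`: binary rationals
`s < 1` have digits that are eventually `0`, and all digits of `s = 1` are `1`. -/
def digit (s : ℝ) (i : ℕ) : Bool :=
  if s = 1 then true else decide (⌊(2 : ℝ) ^ (i + 1) * s⌋ % 2 = 1)

/-- The node `(u₁, …, u_k)` at depth `k` on the path given by the binary expansion of `s`. -/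
def pathNode (s : ℝ) (k : ℕ) : List Bool := List.ofFn fun i : Fin k => digit s i

/-- The silhouette `X_s(T) = min {k : (u₁, …, u_k) ∉ T}`. -/
def silhouette (T : Finset (List Bool)) (s : ℝ) : ℕ := sInf {k | pathNode s k ∉ T}

/-- The integrated silhouette `Y_t(T) = ∫₀ᵗ X_s(T) ds`. -/
def integratedSilhouette (T : Finset (List Bool)) (t : ℝ) : ℝ :=
  ∫ s in (0 : ℝ)..t, (silhouette T s : ℝ)

/-- The discounted external path length `η(T) = ∫₀¹ X_s(T) ds`. -/
def pathLength (T : Finset (List Bool)) : ℝ := integratedSilhouette T 1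

/-- The centered path length `η°(T) = η(T) - H(#T)`, with `H` the harmonic numbers. -/
def centeredPathLength (T : Finset (List Bool)) : ℝ := pathLength T - (harmonic T.card : ℝ)

/-! ### The silhouette is bounded and measurable, so its primitive is continuous -/

theorem exists_pathNode_notMem (T : Finset (List Bool)) :
    ∃ K, ∀ s, pathNode s K ∉ T := by
  refine ⟨T.sup List.length + 1, fun s h => ?_⟩
  have h2 : (pathNode s (T.sup List.length + 1)).length ≤ T.sup List.length :=
    Finset.le_sup (f := List.length) h
  rw [pathNode, List.length_ofFn] at h2
  omega

theorem exists_silhouette_le (T : Finset (List Bool)) : ∃ K, ∀ s, silhouette T s ≤ K := by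
  obtain ⟨K, hK⟩ := exists_pathNode_notMem T
  exact ⟨K, fun s => Nat.sInf_le (hK s)⟩

theorem measurable_digit (i : ℕ) : Measurable fun s => digit s i := by
  have h : Measurable fun s : ℝ => ⌊(2 : ℝ) ^ (i + 1) * s⌋ :=
    Int.measurable_floor.comp (measurable_const_mul _)
  have h2 : Measurable fun s : ℝ => decide (⌊(2 : ℝ) ^ (i + 1) * s⌋ % 2 = 1) :=
    (measurable_from_top (f := fun z : ℤ => decide (z % 2 = 1))).comp h
  exact Measurable.ite (measurableSet_singleton 1) measurable_const h2

theorem measurable_silhouette (T : Finset (List Bool)) : Measurable (silhouette T) := by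
  have hset : ∀ k, MeasurableSet {s | pathNode s k ∉ T} := by
    intro k
    have h1 : Measurable fun s : ℝ => fun i : Fin k => digit s i :=
      measurable_pi_lambda _ fun i => measurable_digit i
    exact h1 (Set.toFinite {v : Fin k → Bool | List.ofFn v ∉ T}).measurableSet
  refine measurable_of_Iic fun n => ?_
  have : silhouette T ⁻¹' Set.Iic n = ⋃ k ∈ Set.Iic n, {s | pathNode s k ∉ T} := by
    ext s
    simp only [Set.mem_preimage, Set.mem_Iic, Set.mem_iUnion, Set.mem_ofPred_eq, exists_prop]
    constructor
    · intro h
      obtain ⟨K, hK⟩ := exists_pathNode_notMem T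
      exact ⟨_, h, Nat.sInf_mem (s := {k | pathNode s k ∉ T}) ⟨K, hK s⟩⟩
    · rintro ⟨k, hk, hk'⟩
      exact (Nat.sInf_le hk').trans hk
  rw [this]
  exact MeasurableSet.biUnion (Set.to_countable _) fun k _ => hset k

theorem intervalIntegrable_silhouette (T : Finset (List Bool)) (a b : ℝ) :
    IntervalIntegrable (fun s => (silhouette T s : ℝ)) volume a b := by
  obtain ⟨K, hK⟩ := exists_silhouette_le T
  refine (intervalIntegrable_const (c := (K : ℝ))).mono_fun ?_ ?_
  · exact ((measurable_from_top (f := fun n : ℕ => (n : ℝ))).comp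
      (measurable_silhouette T)).aestronglyMeasurable
  · exact Eventually.of_forall fun s => by simpa using hK s

theorem continuous_integratedSilhouette (T : Finset (List Bool)) :
    Continuous (integratedSilhouette T) :=
  intervalIntegral.continuous_primitive (intervalIntegrable_silhouette T) 0

/-! ### The state space `S = C₀₀[0,1] × ℝ` -/

/-- `C₀₀[0,1]`: continuous `f : [0,1] → ℝ` with `f 0 = f 1 = 0`, with the supremum norm. -/
def C00 : Submodule ℝ C(I, ℝ) where
  carrier := {f | f 0 = 0 ∧ f 1 = 0}
  zero_mem' := by simp
  add_mem' := by
    rintro f g ⟨hf, hf'⟩ ⟨hg, hg'⟩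
    simp [hf, hf', hg, hg']
  smul_mem' := by
    rintro c f ⟨hf, hf'⟩
    simp [hf, hf']

instance : MeasurableSpace C00 := borel C00

instance : BorelSpace C00 := ⟨rfl⟩

/-- The space `S = C₀₀[0,1] × ℝ` with its (product) topology and Borel σ-algebra. -/
abbrev StateSpace : Type := C00 × ℝ

/-- The normalized integrated silhouette `Y°_t(T) = Y_t(T) - t Y_1(T)`, as element of `C₀₀[0,1]`. -/
def normalizedSilhouette (T : Finset (List Bool)) : C00 :=
  ⟨⟨fun t : I => integratedSilhouette T t - t * integratedSilhouette T 1, by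
      have := continuous_integratedSilhouette T
      fun_prop⟩,
    by simp [integratedSilhouette], by simp⟩

/-! ### The binary search tree algorithm -/

/-- Labeled binary trees. -/
inductive LabeledTree : Type
  | empty : LabeledTree
  | node (label : ℝ) (left right : LabeledTree) : LabeledTree

/-- The set of nodes of a labeled tree. -/
def LabeledTree.nodes : LabeledTree → Finset (List Bool)
  | .empty => ∅
  | .node _ l r => {[]} ∪ l.nodes.image (List.cons false) ∪ r.nodes.image (List.cons true)

/-- Insertion of the value `x`: starting at the root, move to the left if `x` is smaller than the
label of the current node and to the right otherwise, until an empty node is found. -/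
def LabeledTree.insert (x : ℝ) : LabeledTree → LabeledTree
  | .empty => .node x .empty .empty
  | .node a l r => if x < a then .node a (l.insert x) r else .node a l (r.insert x)

/-- The labeled tree that stores the first `n` values `x 0, …, x (n - 1)` of a sequence. -/
def labeledBST (x : ℕ → ℝ) : ℕ → LabeledTree
  | 0 => .empty
  | n + 1 => (labeledBST x n).insert (x n)

/-- The tree `T_n` generated by the algorithm from the first `n` values of the sequence `x`. -/
def bst (x : ℕ → ℝ) (n : ℕ) : Finset (List Bool) := (labeledBST x n).nodes

/-- `Z_n = (Y°(T_n), η°(T_n))`, for the input sequence `x`. -/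
def Z (x : ℕ → ℝ) (n : ℕ) : StateSpace :=
  (normalizedSilhouette (bst x n), centeredPathLength (bst x n))

/-- `sup_{0 ≤ s < t ≤ 1} |f(t) - f(s)| / |t - s| ^ α`, as an element of `[0, ∞]`. -/
def holderSup (α : ℝ) (f : C(I, ℝ)) : ℝ≥0∞ :=
  ⨆ (s : I) (t : I) (_ : s < t), ENNReal.ofReal (|f t - f s| / |(t : ℝ) - s| ^ α)

end Silhouette

end

noncomputable section

namespace Silhouette

/-! ### Tree shapes, their probabilities and means -/

open Finset.HasAntidiagonal (antidiagonal mem_antidiagonal)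

/-! The root of a random search tree with `n + 1` keys splits the other `n` uniformly into sizes `i
+ j = n`, and given the sizes the two subtrees are independent and of the same kind. So a shape has
probability `weight t`, and means over shapes satisfy the recursion `treeMean_succ`. The silhouette
satisfies a matching recursion: on the half `b` of the unit interval it is one plus the rescaled
silhouette of the child on side `b`. Hence its mean over the dyadic interval of a word `v`, minus
the harmonic number of the tree size, is the recursive functional `incr v`, and this is a continuous
functional `quotient v` of the state (`quotient_stateOf`). Everything is read off from these
numbers.

Hölder bound. The tolls average to zero, so the centered path length has exponential moments bounded
uniformly in the size (`treeMean_exp_zeta_le`), and those of `incr v` grow at most like `8 ^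
v.length`. A union bound over all words shows that outside an event of probability `O(1 / M)` all
dyadic quotients grow at most linearly in the level (the set `good M`). Increments at level `k` are
then `O(k / 2 ^ k)`, which gives every exponent below `1`.

No Lipschitz bound. If the children take the fractions `x + y = 1`, their slopes contribute factors
at most `e x` and `e y` to `exp (incr v)`, and `min (x a) (y b) ≤ x y (a + b)`. Averaging over
uniform `x`, each level multiplies the mean of the minimum of `exp (incr v)` by about `2 e / 6 = e /
3 < 1` (`eventually_treeMean_minExp_le`). So this minimum tends to zero with the level and the
quotients are unbounded below.

Existence of the limit. Trees of all sizes are built from one field of uniform splitting variables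
(`coupled`). The contribution of finitely many levels to `incr v` converges almost surely, and the
rest has second moment `O(1 / 2 ^ k)`, so each `incr v` is Cauchy in measure. On `good M` finitely
many quotients control the supremum distance, so the states are Cauchy in measure, hence converge in
measure and in law. The path properties pass to any limit in law by the portmanteau theorem, since
the sets involved are complements of closed sets or finite intersections of open half-spaces. -/

/-- The probability that a random binary search tree has a given shape: the product of the
reciprocals of the sizes of all subtrees. -/
def weight : BinaryTree Unit → ℝ
  | .nil => 1
  | .node _ l r => weight l * weight r / (l.numNodes + r.numNodes + 1)

/-- The mean of `f` over the shape of a random binary search tree with `n` nodes. -/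
def treeMean (n : ℕ) (f : BinaryTree Unit → ℝ) : ℝ :=
  ∑ t ∈ BinaryTree.treesOfNumNodesEq n, weight t * f t

theorem weight_nonneg : ∀ t, 0 ≤ weight t
  | .nil => zero_le_one
  | .node _ l r => by
    have := weight_nonneg l
    have := weight_nonneg r
    rw [weight]
    positivity

theorem treeMean_zero (f : BinaryTree Unit → ℝ) : treeMean 0 f = f .nil := by
  simp [treeMean, BinaryTree.treesOfNumNodesEq_zero, weight]

theorem treeMean_congr {n : ℕ} {f g : BinaryTree Unit → ℝ}
    (h : ∀ t, t.numNodes = n → f t = g t) : treeMean n f = treeMean n g :=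
  Finset.sum_congr rfl fun t ht => by rw [h t (BinaryTree.mem_treesOfNumNodesEq.1 ht)]

theorem treeMean_mono {n : ℕ} {f g : BinaryTree Unit → ℝ}
    (h : ∀ t, t.numNodes = n → f t ≤ g t) : treeMean n f ≤ treeMean n g :=
  Finset.sum_le_sum fun t ht =>
    mul_le_mul_of_nonneg_left (h t (BinaryTree.mem_treesOfNumNodesEq.1 ht)) (weight_nonneg t)

theorem treeMean_nonneg {n : ℕ} {f : BinaryTree Unit → ℝ} (h : ∀ t, 0 ≤ f t) :
    0 ≤ treeMean n f :=
  Finset.sum_nonneg fun t _ => mul_nonneg (weight_nonneg t) (h t)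

theorem treeMean_add (n : ℕ) (f g : BinaryTree Unit → ℝ) :
    treeMean n (fun t => f t + g t) = treeMean n f + treeMean n g := by
  simp [treeMean, mul_add, Finset.sum_add_distrib]

theorem treeMean_const_mul (n : ℕ) (c : ℝ) (f : BinaryTree Unit → ℝ) :
    treeMean n (fun t => c * f t) = c * treeMean n f := by
  simp [treeMean, Finset.mul_sum, mul_left_comm]

theorem treeMean_mul_const (n : ℕ) (c : ℝ) (f : BinaryTree Unit → ℝ) :
    treeMean n (fun t => f t * c) = treeMean n f * c := by
  simp [treeMean, Finset.sum_mul, mul_assoc]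

/-- The first key is equally likely to have any rank, so the sizes are uniform on the antidiagonal,
and the product form of `weight` makes the two subtrees independent given their sizes. -/
theorem treeMean_succ (n : ℕ) (f : BinaryTree Unit → ℝ) :
    treeMean (n + 1) f = (∑ ij ∈ antidiagonal n,
      treeMean ij.1 fun l => treeMean ij.2 fun r => f (.node () l r)) / (n + 1) := by
  have hinj : ∀ a b : Finset (BinaryTree Unit), ∑ t ∈ BinaryTree.pairwiseNode a b, weight t * f t =
      ∑ l ∈ a, ∑ r ∈ b, weight (.node () l r) * f (.node () l r) := by
    intro a b
    rw [BinaryTree.pairwiseNode, Finset.sum_map, Finset.sum_product]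
    rfl
  rw [treeMean, BinaryTree.treesOfNumNodesEq_succ, Finset.sum_biUnion, Finset.sum_div]
  · refine Finset.sum_congr rfl fun ij hij => ?_
    rw [hinj, treeMean, Finset.sum_div]
    refine Finset.sum_congr rfl fun l hl => ?_
    rw [treeMean, Finset.mul_sum, Finset.sum_div]
    refine Finset.sum_congr rfl fun r hr => ?_
    rw [weight, BinaryTree.mem_treesOfNumNodesEq.1 hl, BinaryTree.mem_treesOfNumNodesEq.1 hr]
    have : (n : ℝ) = ij.1 + ij.2 := by
      exact_mod_cast (mem_antidiagonal.1 hij).symm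
    rw [this]
    ring
  · intro a _ b _ hab
    rw [Function.onFun, Finset.disjoint_left]
    intro t ht ht'
    rw [BinaryTree.pairwiseNode, Finset.mem_map] at ht ht'
    obtain ⟨⟨l, r⟩, h1, rfl⟩ := ht
    obtain ⟨⟨l', r'⟩, h2, h3⟩ := ht'
    simp only [Finset.mem_product, BinaryTree.mem_treesOfNumNodesEq] at h1 h2
    obtain ⟨-, h3, h4⟩ := BinaryTree.node.inj h3
    apply hab
    simp only at h3 h4
    rw [Prod.ext_iff, ← h1.1, ← h1.2, ← h2.1, ← h2.2, h3, h4]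
    exact ⟨rfl, rfl⟩

theorem treeMean_one (n : ℕ) : treeMean n (fun _ => 1) = 1 := by
  induction n using Nat.strong_induction_on with
  | _ n ih =>
    cases n with
    | zero => rw [treeMean_zero]
    | succ n =>
      rw [treeMean_succ, Finset.sum_congr rfl (g := fun _ => (1 : ℝ))]
      · rw [Finset.sum_const, Finset.Nat.card_antidiagonal, nsmul_eq_mul]
        push_cast
        field_simp
      · intro ij hij
        have := mem_antidiagonal.1 hij
        rw [ih ij.2 (by omega), ih ij.1 (by omega)]

theorem treeMean_const (n : ℕ) (c : ℝ) : treeMean n (fun _ => c) = c := by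
  have := treeMean_const_mul n c fun _ => 1
  rwa [treeMean_one, mul_one] at this

/-- Bound a mean over trees through the recursive decomposition at the root. -/
theorem treeMean_succ_le {n : ℕ} {f : BinaryTree Unit → ℝ} {g : ℕ × ℕ → ℝ} {c : ℝ}
    (h : ∀ ij ∈ antidiagonal n,
      (treeMean ij.1 fun l => treeMean ij.2 fun r => f (.node () l r)) ≤ g ij)
    (hg : ∑ ij ∈ antidiagonal n, g ij ≤ c * (n + 1)) : treeMean (n + 1) f ≤ c := by
  rw [treeMean_succ, div_le_iff₀ (by positivity)]
  exact (Finset.sum_le_sum h).trans hg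

/-! ### Estimates for harmonic numbers -/

/-- The harmonic numbers as real numbers. -/
def harm (n : ℕ) : ℝ := (harmonic n : ℝ)

theorem harm_zero : harm 0 = 0 := by simp [harm]

theorem harm_succ (n : ℕ) : harm (n + 1) = harm n + 1 / ((n : ℝ) + 1) := by
  simp [harm, harmonic_succ]

theorem harm_mono : Monotone harm :=
  monotone_nat_of_le_succ fun n => by
    rw [harm_succ]
    have : (0 : ℝ) ≤ 1 / ((n : ℝ) + 1) := by positivity
    linarith

/-- A version of `harm n ≈ log n` without error term: each step uses `exp (1 / (n + 1)) ≥ (n + 2) /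
(n + 1)`. -/
theorem exp_harm_sub_le {i n : ℕ} (h : i ≤ n) :
    Real.exp (harm i - harm n) ≤ ((i : ℝ) + 1) / (n + 1) := by
  induction n, h using Nat.le_induction with
  | base => rw [sub_self, Real.exp_zero, div_self (by positivity)]
  | succ n _ ih =>
    have h1 : Real.exp (-(1 / ((n : ℝ) + 1))) ≤ ((n : ℝ) + 1) / (n + 2) := by
      rw [Real.exp_neg, inv_le_comm₀ (Real.exp_pos _) (by positivity)]
      refine le_trans (le_of_eq ?_) (Real.add_one_le_exp _)
      field_simp
      ring
    have h2 : harm i - harm (n + 1) = (harm i - harm n) + -(1 / ((n : ℝ) + 1)) := by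
      rw [harm_succ]; ring
    rw [h2, Real.exp_add]
    refine (mul_le_mul ih h1 (Real.exp_pos _).le (by positivity)).trans (le_of_eq ?_)
    push_cast
    field_simp
    ring

theorem sum_antidiagonal_fst (n : ℕ) (f : ℕ → ℝ) :
    ∑ ij ∈ antidiagonal n, f ij.1 = ∑ i ∈ Finset.range (n + 1), f i :=
  Finset.Nat.sum_antidiagonal_eq_sum_range_succ_mk (fun ij : ℕ × ℕ => f ij.1) n

theorem sum_antidiagonal_snd (n : ℕ) (f : ℕ → ℝ) :
    ∑ ij ∈ antidiagonal n, f ij.2 = ∑ i ∈ Finset.range (n + 1), f i := by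
  rw [← sum_antidiagonal_fst]
  exact Finset.Nat.sum_antidiagonal_swap (f := fun ij : ℕ × ℕ => f ij.1)

theorem sum_range_harm (n : ℕ) :
    ∑ i ∈ Finset.range (n + 1), harm i = (n + 1) * (harm (n + 1) - 1) := by
  induction n with
  | zero => simp [harm_succ, harm_zero]
  | succ n ih =>
    rw [Finset.sum_range_succ, ih, harm_succ (n + 1)]
    push_cast
    field_simp
    ring

/-- The summand behaves like `sqrt (n / i)`, whose sum over `i` is of order `n`. This makes the
unbounded toll harmless on average. -/
theorem sum_range_exp_harm_sub_le (n : ℕ) :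
    ∑ i ∈ Finset.range (n + 1), Real.exp ((harm (n + 1) - harm i) / 2) ≤ 4 * (n + 1) := by
  -- The denominator `4 * m + 1` is weaker than necessary, chosen to cancel the factor `4 * (n + 1)
  -- + 1` that the induction produces at `m = n + 1`.
  have key : ∀ m : ℕ, Real.exp (1 / ((m : ℝ) + 1) / 2) ≤ 4 * (m + 1) / (4 * m + 1) := by
    intro m
    have h1 := Real.add_one_le_exp (-(1 / ((m : ℝ) + 1) / 2))
    rw [Real.exp_neg] at h1
    have h2 : (4 * (m : ℝ) + 1) / (4 * (m + 1)) ≤ -(1 / ((m : ℝ) + 1) / 2) + 1 := by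
      rw [div_le_iff₀ (by positivity)]
      field_simp
      linarith
    have h3 := (inv_le_inv₀ (inv_pos.2 (Real.exp_pos _)) (by positivity)).2 (h2.trans h1)
    rwa [inv_inv, inv_div] at h3
  have step : ∀ m i : ℕ, Real.exp ((harm (m + 1) - harm i) / 2) =
      Real.exp (1 / ((m : ℝ) + 1) / 2) * Real.exp ((harm m - harm i) / 2) := by
    intro m i
    rw [← Real.exp_add, harm_succ]
    congr 1
    ring
  induction n with
  | zero =>
    simp only [zero_add, Finset.range_one, Finset.sum_singleton, harm_succ, harm_zero]
    have := key 0
    norm_num at this ⊢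
    exact this
  | succ n ih =>
    simp_rw [step (n + 1)]
    rw [← Finset.mul_sum, Finset.sum_range_succ, sub_self, zero_div, Real.exp_zero]
    have h := key (n + 1)
    rw [le_div_iff₀ (by positivity)] at h
    calc _ ≤ Real.exp (1 / (((n + 1 : ℕ) : ℝ) + 1) / 2) * (4 * (n + 1) + 1) := by gcongr
      _ ≤ _ := by
        push_cast at h ⊢
        linarith

theorem sum_antidiagonal_exp_fst_le (n : ℕ) :
    ∑ ij ∈ antidiagonal n, Real.exp ((harm (n + 1) - harm ij.1) / 2) ≤ 4 * (n + 1) :=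
  (sum_antidiagonal_fst n fun i => Real.exp ((harm (n + 1) - harm i) / 2)).trans_le
    (sum_range_exp_harm_sub_le n)

theorem sum_antidiagonal_exp_snd_le (n : ℕ) :
    ∑ ij ∈ antidiagonal n, Real.exp ((harm (n + 1) - harm ij.2) / 2) ≤ 4 * (n + 1) :=
  (sum_antidiagonal_snd n fun i => Real.exp ((harm (n + 1) - harm i) / 2)).trans_le
    (sum_range_exp_harm_sub_le n)

/-! ### The toll function -/

/-- The contribution of the root to the centered path length. -/
def toll (i j : ℕ) : ℝ := 1 - harm (i + j + 1) + (harm i + harm j) / 2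

/-- Centering by harmonic numbers is exact: it makes the toll have mean zero over the uniform split,
so no first-order term survives in the moment bounds. -/
theorem sum_toll (n : ℕ) : ∑ ij ∈ antidiagonal n, toll ij.1 ij.2 = 0 := by
  have h : ∀ ij ∈ antidiagonal n, toll ij.1 ij.2 =
      (1 - harm (n + 1)) + (harm ij.1 / 2 + harm ij.2 / 2) := by
    intro ij hij
    rw [toll, mem_antidiagonal.1 hij]
    ring
  rw [Finset.sum_congr rfl h, Finset.sum_add_distrib, Finset.sum_add_distrib,
    sum_antidiagonal_fst n fun i => harm i / 2, sum_antidiagonal_snd n fun i => harm i / 2,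
    ← Finset.sum_div, sum_range_harm, Finset.sum_const, Finset.Nat.card_antidiagonal, nsmul_eq_mul]
  push_cast
  ring

/-- The constant comes from the quadratic term `(|x| / 4) ^ 2 / 2 = x ^ 2 / 32` of the exponential
series. -/
theorem sq_le_exp_abs (x : ℝ) : x ^ 2 ≤ 32 * Real.exp (|x| / 4) := by
  have := Real.quadratic_le_exp_of_nonneg (x := |x| / 4) (by positivity)
  have h2 : (|x| / 4) ^ 2 = x ^ 2 / 16 := by rw [div_pow, sq_abs]; norm_num
  have h3 : 0 ≤ |x| / 4 := by positivity
  rw [h2] at this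
  linarith

theorem exp_le_one_add_add_sq {y : ℝ} (hy : y ≤ 1) : Real.exp y ≤ 1 + y + y ^ 2 := by
  rcases le_or_gt (-1) y with h | h
  · have := (abs_le.1 (Real.abs_exp_sub_one_sub_id_le (abs_le.2 ⟨h, hy⟩))).2
    linarith
  · have : Real.exp y ≤ 1 := Real.exp_le_one_iff.2 (by linarith)
    nlinarith

/-- A second-order expansion whose remainder is summable by `sum_range_exp_harm_sub_le`. The range
of `x` is asymmetric because the toll is at most `1` but not bounded below by a constant; the value
`x = 1` is needed later for `minExp`. -/
theorem exp_mul_toll_le {n i j : ℕ} (hij : i + j = n) {x : ℝ} (hx : -(1 / 4) ≤ x) (hx1 : x ≤ 1) :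
    Real.exp (x * toll i j) ≤ 1 + x * toll i j + 32 * x ^ 2 *
      (Real.exp ((harm (n + 1) - harm i) / 2) + Real.exp ((harm (n + 1) - harm j) / 2)) := by
  set a := harm (n + 1) - harm i with ha
  set b := harm (n + 1) - harm j with hb
  set c := toll i j with hc
  have ha0 : 0 ≤ a := sub_nonneg.2 (harm_mono (by omega))
  have hb0 : 0 ≤ b := sub_nonneg.2 (harm_mono (by omega))
  have hcab : c = 1 - (a + b) / 2 := by
    rw [hc, toll, hij, ha, hb]; ring
  have hc1 : c ≤ 1 := by linarith
  have habs : |c| ≤ 1 + (a + b) / 2 := abs_le.2 ⟨by linarith, by linarith⟩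
  -- From `|c| / 2 ≤ 1 / 2 + a / 4 + b / 4` and `exp (1 / 2) ≤ 2`, followed by `2 p q ≤ p ^ 2 + q ^
  -- 2`.
  have hexp : Real.exp (|c| / 2) ≤ Real.exp (a / 2) + Real.exp (b / 2) := by
    have h1 : Real.exp (|c| / 2) ≤ Real.exp (1 / 2) * (Real.exp (a / 4) * Real.exp (b / 4)) := by
      rw [← Real.exp_add, ← Real.exp_add]
      exact Real.exp_le_exp.2 (by linarith)
    have h2 : Real.exp (1 / 2) ≤ 2 := by
      have h := exp_le_one_add_add_sq (y := 1 / 2) (by norm_num)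
      norm_num at h ⊢
      linarith
    have h3 : Real.exp (a / 2) = Real.exp (a / 4) ^ 2 := by
      rw [← Real.exp_nat_mul]; congr 1; push_cast; ring
    have h4 : Real.exp (b / 2) = Real.exp (b / 4) ^ 2 := by
      rw [← Real.exp_nat_mul]; congr 1; push_cast; ring
    have h5 : 0 < Real.exp (a / 4) * Real.exp (b / 4) := by positivity
    rw [h3, h4]
    nlinarith [sq_nonneg (Real.exp (a / 4) - Real.exp (b / 4))]
  have hmain : Real.exp (x * c) ≤ 1 + x * c + (x * c) ^ 2 * Real.exp (|c| / 4) := by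
    have h1 : 1 ≤ Real.exp (|c| / 4) := Real.one_le_exp (by positivity)
    rcases le_or_gt (x * c) 1 with h | h
    · refine (exp_le_one_add_add_sq h).trans ?_
      nlinarith [sq_nonneg (x * c)]
    -- When `x * c > 1`, necessarily `x` and `c` are both negative, since `x ≤ 1` and `c ≤ 1`; then
    -- `|x| ≤ 1 / 4` gives the bound.
    · have h2 : x * c ≤ |c| / 4 := by
        rcases le_or_gt 0 x with h0 | h0
        · nlinarith
        · rcases le_or_gt 0 c with h3 | h3
          · nlinarith
          · rw [abs_of_neg h3]; nlinarith
      have h3 := Real.exp_le_exp.2 h2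
      have h4 : 1 ≤ (x * c) ^ 2 := one_le_pow₀ h.le
      have h5 := mul_le_mul_of_nonneg_right h4 (Real.exp_pos (|c| / 4)).le
      linarith
  have hsq : (x * c) ^ 2 * Real.exp (|c| / 4) ≤ 32 * x ^ 2 * Real.exp (|c| / 2) := by
    have h1 : Real.exp (|c| / 2) = Real.exp (|c| / 4) * Real.exp (|c| / 4) := by
      rw [← Real.exp_add]; congr 1; ring
    rw [mul_pow, h1]
    have h2 := mul_le_mul_of_nonneg_left (sq_le_exp_abs c)
      (mul_nonneg (sq_nonneg x) (Real.exp_pos (|c| / 4)).le)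
    linarith
  have := mul_le_mul_of_nonneg_left hexp (show 0 ≤ 32 * x ^ 2 by positivity)
  linarith

theorem sum_exp_mul_toll_le (n : ℕ) {x : ℝ} (hx : -(1 / 4) ≤ x) (hx1 : x ≤ 1) :
    ∑ ij ∈ antidiagonal n, Real.exp (x * toll ij.1 ij.2) ≤
      Real.exp (256 * x ^ 2) * (n + 1) := by
  calc _ ≤ ∑ ij ∈ antidiagonal n, (1 + x * toll ij.1 ij.2 + 32 * x ^ 2 *
      (Real.exp ((harm (n + 1) - harm ij.1) / 2) +
        Real.exp ((harm (n + 1) - harm ij.2) / 2))) :=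
        Finset.sum_le_sum fun ij hij => exp_mul_toll_le (mem_antidiagonal.1 hij) hx hx1
    _ ≤ (1 + 256 * x ^ 2) * (n + 1) := by
      rw [Finset.sum_add_distrib, Finset.sum_add_distrib, ← Finset.mul_sum, ← Finset.mul_sum,
        Finset.sum_add_distrib, sum_toll, Finset.sum_const, Finset.Nat.card_antidiagonal,
        nsmul_eq_mul]
      have h := mul_le_mul_of_nonneg_left (add_le_add (sum_antidiagonal_exp_fst_le n)
        (sum_antidiagonal_exp_snd_le n)) (show 0 ≤ 32 * x ^ 2 by positivity)
      push_cast
      linarith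
    _ ≤ _ := by
      have := Real.add_one_le_exp (256 * x ^ 2)
      gcongr
      linarith

/-! ### The centered path length of a tree shape and its moments -/

/-- The centered path length of a tree shape. -/
def zeta : BinaryTree Unit → ℝ
  | .nil => 0
  | .node _ l r => toll l.numNodes r.numNodes + (zeta l + zeta r) / 2

/-- Exchange a mean of a product over both subtrees for the product of the means. -/
theorem treeMean_mul_treeMean (i j : ℕ) (c : ℝ) (f g : BinaryTree Unit → ℝ) :
    (treeMean i fun l => treeMean j fun r => c * (f l * g r)) =
      c * (treeMean i f * treeMean j g) := by
  simp_rw [treeMean_const_mul, treeMean_mul_const]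

/-- Both subtrees enter with factor one half, so the induction hypothesis at `x / 2` costs `2 * 512
* (x / 2) ^ 2 = 256 * x ^ 2`, leaving exactly `256 * x ^ 2` for the toll. The constant does not
depend on `n`. -/
theorem treeMean_exp_zeta_le (n : ℕ) {x : ℝ} (hx : -(1 / 4) ≤ x) (hx1 : x ≤ 1) :
    treeMean n (fun t => Real.exp (x * zeta t)) ≤ Real.exp (512 * x ^ 2) := by
  induction n using Nat.strong_induction_on generalizing x with
  | _ n ih =>
    cases n with
    | zero =>
      rw [treeMean_zero, zeta, mul_zero]
      exact Real.exp_le_exp.2 (by positivity)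
    | succ n =>
      refine treeMean_succ_le (g := fun ij => Real.exp (x * toll ij.1 ij.2) *
        Real.exp (256 * x ^ 2)) (fun ij hij => ?_) ?_
      · have h1 := mem_antidiagonal.1 hij
        have h2 : (treeMean ij.1 fun l => treeMean ij.2 fun r =>
            Real.exp (x * zeta (.node () l r))) = Real.exp (x * toll ij.1 ij.2) *
            (treeMean ij.1 (fun l => Real.exp (x / 2 * zeta l)) *
              treeMean ij.2 (fun r => Real.exp (x / 2 * zeta r))) := by
          rw [← treeMean_mul_treeMean]
          refine treeMean_congr fun l hl => treeMean_congr fun r hr => ?_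
          rw [zeta, hl, hr, ← Real.exp_add, ← Real.exp_add]
          congr 1
          ring
        rw [h2]
        have h3 := ih ij.1 (by omega) (x := x / 2) (by linarith) (by linarith)
        have h4 := ih ij.2 (by omega) (x := x / 2) (by linarith) (by linarith)
        have h5 : Real.exp (256 * x ^ 2) =
            Real.exp (512 * (x / 2) ^ 2) * Real.exp (512 * (x / 2) ^ 2) := by
          rw [← Real.exp_add]; congr 1; ring
        rw [h5]
        have h6 : 0 ≤ treeMean ij.2 (fun r => Real.exp (x / 2 * zeta r)) :=
          treeMean_nonneg fun t => (Real.exp_pos _).le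
        gcongr
      · rw [← Finset.sum_mul]
        have h := mul_le_mul_of_nonneg_right (sum_exp_mul_toll_le n hx hx1)
          (Real.exp_pos (256 * x ^ 2)).le
        have h5 : Real.exp (512 * x ^ 2) = Real.exp (256 * x ^ 2) * Real.exp (256 * x ^ 2) := by
          rw [← Real.exp_add]; congr 1; ring
        rw [h5]
        linarith

/-- A constant dominating the exponential moments of the centered path lengths. -/
def momentBound : ℝ := 2 * Real.exp 32

theorem momentBound_pos : 0 < momentBound := by
  rw [momentBound]; positivity

theorem treeMean_exp_abs_zeta_le (n : ℕ) :
    treeMean n (fun t => Real.exp (|zeta t| / 4)) ≤ momentBound := by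
  have h1 := treeMean_exp_zeta_le n (x := 1 / 4) (by norm_num) (by norm_num)
  have h2 := treeMean_exp_zeta_le n (x := -(1 / 4)) (by norm_num) (by norm_num)
  norm_num at h1 h2
  calc _ ≤ treeMean n (fun t => Real.exp (1 / 4 * zeta t) + Real.exp (-(1 / 4 * zeta t))) := by
        refine treeMean_mono fun t _ => ?_
        have := Real.exp_pos (1 / 4 * zeta t)
        have := Real.exp_pos (-(1 / 4 * zeta t))
        rcases abs_cases (zeta t) with ⟨h, _⟩ | ⟨h, _⟩
        · rw [h, show zeta t / 4 = 1 / 4 * zeta t by ring]; linarith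
        · rw [h, show -zeta t / 4 = -(1 / 4 * zeta t) by ring]; linarith
    _ ≤ _ := by
      rw [treeMean_add, momentBound]
      linarith

theorem treeMean_zeta (n : ℕ) : treeMean n zeta = 0 := by
  induction n using Nat.strong_induction_on with
  | _ n ih =>
    cases n with
    | zero => rw [treeMean_zero, zeta]
    | succ n =>
      have : ∀ ij ∈ antidiagonal n, (treeMean ij.1 fun l => treeMean ij.2 fun r =>
          zeta (.node () l r)) = toll ij.1 ij.2 := by
        intro ij hij
        have h1 := mem_antidiagonal.1 hij
        have h2 : (treeMean ij.1 fun l => treeMean ij.2 fun r => zeta (.node () l r)) =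
            treeMean ij.1 fun l => treeMean ij.2 fun r =>
              toll ij.1 ij.2 + (1 / 2 * zeta l + 1 / 2 * zeta r) := by
          refine treeMean_congr fun l hl => treeMean_congr fun r hr => ?_
          rw [zeta, hl, hr]
          ring
        rw [h2]
        simp_rw [treeMean_add, treeMean_const, treeMean_const_mul]
        rw [ih ij.2 (by omega), ih ij.1 (by omega)]
        ring
      rw [treeMean_succ, Finset.sum_congr rfl this, sum_toll, zero_div]

/-! ### Increments over dyadic intervals -/

/-- The subtree on the side `b` of the root. -/
def child (b : Bool) (l r : BinaryTree Unit) : BinaryTree Unit := if b then r else l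

/-- The extra slope on the half `b` of the unit interval caused by the split at the root. -/
def slope (b : Bool) (l r : BinaryTree Unit) : ℝ :=
  1 + harm (child b l r).numNodes - harm (l.numNodes + r.numNodes + 1)

/-- The mean of the silhouette over the dyadic interval that belongs to the node `v`, minus the
harmonic number of the size of the tree. -/
def incr : List Bool → BinaryTree Unit → ℝ
  | [], t => zeta t
  | _ :: _, .nil => 0
  | b :: w, .node _ l r => incr w (child b l r) + slope b l r

/-- Each level costs at most a factor `8 = 2 * 4`: `exp (1 / 4) ≤ 2` from the constant in the slope,
and `4` from averaging the harmonic difference over the split. -/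
theorem treeMean_exp_abs_incr_le (v : List Bool) (n : ℕ) :
    treeMean n (fun t => Real.exp (|incr v t| / 4)) ≤ momentBound * 8 ^ v.length := by
  induction v generalizing n with
  | nil => simpa [incr] using treeMean_exp_abs_zeta_le n
  | cons b w ih =>
    cases n with
    | zero =>
      have h : (1 : ℝ) ≤ momentBound := by
        rw [momentBound]
        have := Real.add_one_le_exp (32 : ℝ)
        linarith
      rw [treeMean_zero, incr, abs_zero, zero_div, Real.exp_zero]
      exact one_le_mul_of_one_le_of_one_le h (one_le_pow₀ (by norm_num))
    | succ n =>
      set N : ℕ × ℕ → ℕ := fun ij => if b then ij.2 else ij.1 with hN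
      refine treeMean_succ_le (g := fun ij => 2 * Real.exp ((harm (n + 1) - harm (N ij)) / 2) *
        (momentBound * 8 ^ w.length)) (fun ij hij => ?_) ?_
      · have h1 := mem_antidiagonal.1 hij
        have hNle : N ij ≤ n + 1 := by
          rw [hN]; dsimp only; split_ifs <;> omega
        have ha : 0 ≤ harm (n + 1) - harm (N ij) := sub_nonneg.2 (harm_mono hNle)
        have h2 : (treeMean ij.1 fun l => treeMean ij.2 fun r =>
            Real.exp (|incr (b :: w) (.node () l r)| / 4)) ≤
            treeMean ij.1 fun l => treeMean ij.2 fun r =>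
              2 * Real.exp ((harm (n + 1) - harm (N ij)) / 2) *
                Real.exp (|incr w (child b l r)| / 4) := by
          refine treeMean_mono fun l hl => treeMean_mono fun r hr => ?_
          have hs : slope b l r = 1 - (harm (n + 1) - harm (N ij)) := by
            have : (child b l r).numNodes = N ij := by
              cases b <;> simp [hN, child, hl, hr]
            rw [slope, this, hl, hr, h1]
            ring
          have h3 : |incr (b :: w) (.node () l r)| ≤ |incr w (child b l r)| +
              (1 + (harm (n + 1) - harm (N ij))) := by
            rw [incr]
            refine (abs_add_le _ _).trans (add_le_add le_rfl ?_)
            rw [hs]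
            exact abs_le.2 ⟨by linarith, by linarith⟩
          have h4 : Real.exp (1 / 4) ≤ 2 := by
            have h := exp_le_one_add_add_sq (y := 1 / 4) (by norm_num)
            norm_num at h ⊢
            linarith
          calc _ ≤ Real.exp (1 / 4) * Real.exp ((harm (n + 1) - harm (N ij)) / 2) *
                Real.exp (|incr w (child b l r)| / 4) := by
                rw [← Real.exp_add, ← Real.exp_add]
                exact Real.exp_le_exp.2 (by linarith)
            _ ≤ _ := by gcongr
        refine h2.trans ?_
        simp_rw [treeMean_const_mul]
        have h3 : (treeMean ij.1 fun l => treeMean ij.2 fun r =>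
            Real.exp (|incr w (child b l r)| / 4)) ≤ momentBound * 8 ^ w.length := by
          cases b
          · simp only [child, Bool.false_eq_true, if_false, treeMean_const]
            exact ih ij.1
          · simp only [child, if_true, treeMean_const]
            exact ih ij.2
        exact mul_le_mul_of_nonneg_left h3 (by positivity)
      · rw [← Finset.sum_mul, ← Finset.mul_sum, List.length_cons, pow_succ]
        have h : ∑ ij ∈ antidiagonal n, Real.exp ((harm (n + 1) - harm (N ij)) / 2) ≤
            4 * (n + 1) := by
          cases b
          · simpa [hN] using sum_antidiagonal_exp_fst_le n
          · simpa [hN] using sum_antidiagonal_exp_snd_le n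
        have hp : 0 ≤ momentBound * 8 ^ w.length := by
          have := momentBound_pos; positivity
        have := mul_le_mul_of_nonneg_right h hp
        linarith

/-! ### Truncation of the centered path length -/

/-- What is left of the centered path length when the contributions of the first `k` levels are
removed. -/
def tail : ℕ → BinaryTree Unit → ℝ
  | 0, t => zeta t
  | _ + 1, .nil => 0
  | k + 1, .node _ l r => (tail k l + tail k r) / 2

/-- The part of `incr` that stems from the levels beyond the first `k` below the node. -/
def incrTail (k : ℕ) : List Bool → BinaryTree Unit → ℝ
  | [], t => tail k t
  | _ :: _, .nil => 0
  | b :: w, .node _ l r => incrTail k w (child b l r)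

theorem treeMean_tail (k n : ℕ) : treeMean n (tail k) = 0 := by
  induction k generalizing n with
  | zero => exact treeMean_zeta n
  | succ k ih =>
    cases n with
    | zero => rw [treeMean_zero, tail]
    | succ n =>
      rw [treeMean_succ, Finset.sum_eq_zero, zero_div]
      intro ij _
      have : (treeMean ij.1 fun l => treeMean ij.2 fun r => tail (k + 1) (.node () l r)) =
          treeMean ij.1 fun l => treeMean ij.2 fun r => 1 / 2 * tail k l + 1 / 2 * tail k r :=
        treeMean_congr fun l _ => treeMean_congr fun r _ => by rw [tail]; ring
      rw [this]
      simp_rw [treeMean_add, treeMean_const, treeMean_const_mul, ih]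
      norm_num

/-- The tails of the two subtrees are independent with mean zero, so the cross term vanishes and
averaging them halves the second moment at each level. -/
theorem treeMean_tail_sq_le (k n : ℕ) :
    treeMean n (fun t => tail k t ^ 2) ≤ 32 * momentBound / 2 ^ k := by
  induction k generalizing n with
  | zero =>
    calc _ ≤ treeMean n (fun t => 32 * Real.exp (|zeta t| / 4)) :=
          treeMean_mono fun t _ => sq_le_exp_abs _
      _ ≤ _ := by
        rw [treeMean_const_mul, pow_zero, div_one]
        exact mul_le_mul_of_nonneg_left (treeMean_exp_abs_zeta_le n) (by norm_num)
  | succ k ih =>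
    cases n with
    | zero =>
      have := momentBound_pos
      rw [treeMean_zero, tail, zero_pow two_ne_zero]
      positivity
    | succ n =>
      refine treeMean_succ_le (g := fun _ => 32 * momentBound / 2 ^ (k + 1)) (fun ij _ => ?_) ?_
      · have : (treeMean ij.1 fun l => treeMean ij.2 fun r => tail (k + 1) (.node () l r) ^ 2) =
            treeMean ij.1 fun l => treeMean ij.2 fun r => 1 / 4 * tail k l ^ 2 +
              (1 / 4 * tail k r ^ 2 + 1 / 2 * (tail k l * tail k r)) :=
          treeMean_congr fun l _ => treeMean_congr fun r _ => by rw [tail]; ring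
        rw [this]
        simp_rw [treeMean_add, treeMean_const, treeMean_const_mul, treeMean_mul_const,
          treeMean_tail]
        have h1 := ih ij.1
        have h2 := ih ij.2
        have h3 : 32 * momentBound / 2 ^ (k + 1) = 32 * momentBound / 2 ^ k / 2 := by
          rw [pow_succ, div_div]
        rw [h3]
        linarith
      · rw [Finset.sum_const, Finset.Nat.card_antidiagonal, nsmul_eq_mul]
        push_cast
        linarith

/-- Following `v` only replaces the tree by a random subtree, and the bound for `tail k` is uniform
in the size. -/
theorem treeMean_incrTail_sq_le (k : ℕ) (v : List Bool) (n : ℕ) :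
    treeMean n (fun t => incrTail k v t ^ 2) ≤ 32 * momentBound / 2 ^ k := by
  induction v generalizing n with
  | nil => simpa only [incrTail] using treeMean_tail_sq_le k n
  | cons b w ih =>
    cases n with
    | zero =>
      have := momentBound_pos
      rw [treeMean_zero, incrTail, zero_pow two_ne_zero]
      positivity
    | succ n =>
      refine treeMean_succ_le (g := fun _ => 32 * momentBound / 2 ^ k) (fun ij _ => ?_) ?_
      · cases b
        · simp only [incrTail, child, Bool.false_eq_true, if_false, treeMean_const]
          exact ih ij.1
        · simp only [incrTail, child, if_true, treeMean_const]
          exact ih ij.2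
      · rw [Finset.sum_const, Finset.Nat.card_antidiagonal, nsmul_eq_mul]
        push_cast
        linarith

/-! ### Small increments exist at every level -/

/-- The minimum of `exp (incr v t)` over the words `v` of length `m`. -/
def minExp : ℕ → BinaryTree Unit → ℝ
  | 0, t => Real.exp (zeta t)
  | _ + 1, .nil => 1
  | m + 1, .node _ l r => min (Real.exp (slope false l r) * minExp m l)
      (Real.exp (slope true l r) * minExp m r)

theorem minExp_pos : ∀ (m : ℕ) (t : BinaryTree Unit), 0 < minExp m t
  | 0, _ => Real.exp_pos _
  | _ + 1, .nil => zero_lt_one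
  | m + 1, .node _ l r => lt_min (mul_pos (Real.exp_pos _) (minExp_pos m l))
      (mul_pos (Real.exp_pos _) (minExp_pos m r))

theorem exists_exp_incr_eq_minExp (m : ℕ) (t : BinaryTree Unit) :
    ∃ v : List Bool, v.length = m ∧ Real.exp (incr v t) = minExp m t := by
  induction m generalizing t with
  | zero => exact ⟨[], rfl, rfl⟩
  | succ m ih =>
    cases t with
    | nil => exact ⟨List.replicate (m + 1) false, by simp, by simp [List.replicate_succ, incr, minExp]⟩
    | node _ l r =>
      rw [minExp]
      obtain ⟨v, hv, hv'⟩ := ih l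
      obtain ⟨w, hw, hw'⟩ := ih r
      rcases min_choice (Real.exp (slope false l r) * minExp m l)
        (Real.exp (slope true l r) * minExp m r) with h | h
      · refine ⟨false :: v, by simp [hv], ?_⟩
        rw [h, incr, add_comm, Real.exp_add, ← hv']
        rfl
      · refine ⟨true :: w, by simp [hw], ?_⟩
        rw [h, incr, add_comm, Real.exp_add, ← hw']
        rfl

/-- The minimum is at most the weighted mean with crossed weights, `y` for `x * a` and `x` for `y *
b`. -/
theorem min_mul_le {x y a b : ℝ} (hx : 0 ≤ x) (hy : 0 ≤ y) (hxy : x + y = 1) :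
    min (x * a) (y * b) ≤ x * y * (a + b) := by
  have h1 := mul_le_mul_of_nonneg_left (min_le_left (x * a) (y * b)) hy
  have h2 := mul_le_mul_of_nonneg_left (min_le_right (x * a) (y * b)) hx
  have h3 : min (x * a) (y * b) = y * min (x * a) (y * b) + x * min (x * a) (y * b) := by
    rw [← add_mul, add_comm y, hxy, one_mul]
  rw [h3]
  linarith

/-- By `exp_harm_sub_le` the slopes contribute at most `e (i + 1) / (n + 2)` and `e (j + 1) / (n +
2)`; these fractions add up to one because `i + j = n`, so `min_mul_le` applies. -/
theorem minExp_node_le {n : ℕ} (m : ℕ) (l r : BinaryTree Unit) (h : l.numNodes + r.numNodes = n) :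
    minExp (m + 1) (.node () l r) ≤ Real.exp 1 *
      (((l.numNodes : ℝ) + 1) * (r.numNodes + 1) / (n + 2) ^ 2) * (minExp m l + minExp m r) := by
  have hs : ∀ b, Real.exp (slope b l r) ≤
      Real.exp 1 * ((((child b l r).numNodes : ℝ) + 1) / (n + 2)) := by
    intro b
    have hle : (child b l r).numNodes ≤ n + 1 := by cases b <;> simp [child] <;> omega
    have h1 := exp_harm_sub_le hle
    rw [slope, h, add_sub_assoc, Real.exp_add]
    refine mul_le_mul_of_nonneg_left (h1.trans_eq ?_) (Real.exp_pos 1).le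
    push_cast
    ring
  rw [minExp]
  have hl := mul_le_mul_of_nonneg_right (hs false) (minExp_pos m l).le
  have hr := mul_le_mul_of_nonneg_right (hs true) (minExp_pos m r).le
  simp only [child, Bool.false_eq_true, if_false, if_true] at hl hr
  refine (min_le_min hl hr).trans ?_
  have hxy : ((l.numNodes : ℝ) + 1) / (n + 2) + ((r.numNodes : ℝ) + 1) / (n + 2) = 1 := by
    rw [← h]; push_cast; field_simp; ring
  have := min_mul_le (a := Real.exp 1 * minExp m l) (b := Real.exp 1 * minExp m r)
    (by positivity) (by positivity) hxy
  refine (le_of_eq ?_).trans (this.trans (le_of_eq ?_))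
  · congr 1 <;> ring
  · field_simp

/-- The factor `2` comes from the symmetry between left and right, which leaves a sum over the left
subtree only. -/
theorem treeMean_minExp_succ_le (m n : ℕ) :
    treeMean (n + 1) (minExp (m + 1)) ≤ 2 * Real.exp 1 / ((n + 1) * (n + 2) ^ 2) *
      ∑ ij ∈ antidiagonal n, ((ij.1 : ℝ) + 1) * (ij.2 + 1) * treeMean ij.1 (minExp m) := by
  rw [treeMean_succ, div_le_iff₀ (by positivity)]
  have h : ∀ ij ∈ antidiagonal n,
      (treeMean ij.1 fun l => treeMean ij.2 fun r => minExp (m + 1) (.node () l r)) ≤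
      Real.exp 1 / (n + 2) ^ 2 * (((ij.1 : ℝ) + 1) * (ij.2 + 1) * treeMean ij.1 (minExp m)) +
      Real.exp 1 / (n + 2) ^ 2 * (((ij.2 : ℝ) + 1) * (ij.1 + 1) * treeMean ij.2 (minExp m)) := by
    intro ij hij
    have hij := mem_antidiagonal.1 hij
    calc _ ≤ treeMean ij.1 fun l => treeMean ij.2 fun r => Real.exp 1 *
        (((ij.1 : ℝ) + 1) * (ij.2 + 1) / (n + 2) ^ 2) * (minExp m l + minExp m r) := by
          refine treeMean_mono fun l hl => treeMean_mono fun r hr => ?_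
          have := minExp_node_le m l r (by rw [hl, hr, hij] : l.numNodes + r.numNodes = n)
          rwa [hl, hr] at this
      _ = _ := by
        simp_rw [treeMean_const_mul, treeMean_add, treeMean_const]
        ring
  refine (Finset.sum_le_sum h).trans (le_of_eq ?_)
  rw [Finset.sum_add_distrib, ← Finset.mul_sum, ← Finset.mul_sum,
    ← Finset.Nat.sum_antidiagonal_swap (f := fun ij : ℕ × ℕ =>
      ((ij.1 : ℝ) + 1) * (ij.2 + 1) * treeMean ij.1 (minExp m))]
  simp only [Prod.fst_swap, Prod.snd_swap]
  field_simp
  ring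

theorem sum_antidiagonal_mul (n : ℕ) :
    ∑ ij ∈ antidiagonal n, ((ij.1 : ℝ) + 1) * (ij.2 + 1) = (n + 1) * (n + 2) * (n + 3) / 6 := by
  rw [Finset.Nat.sum_antidiagonal_eq_sum_range_succ_mk]
  -- For the induction the parameter `N` of the summand is separated from the number `m` of terms.
  have h : ∀ N m : ℕ, ∑ i ∈ Finset.range m, ((i : ℝ) + 1) * ((N : ℝ) - i + 1) =
      m * (m + 1) * (3 * N + 5 - 2 * m) / 6 := by
    intro N m
    induction m with
    | zero => simp
    | succ m ih => rw [Finset.sum_range_succ, ih]; push_cast; ring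
  rw [← (show _ = (n + 1 : ℝ) * (n + 2) * (n + 3) / 6 from (h n (n + 1)).trans (by push_cast; ring))]
  refine Finset.sum_congr rfl fun i hi => ?_
  rw [Nat.cast_sub (by have := Finset.mem_range.1 hi; omega)]

/-- A crude bound for all sizes; it serves for the boundedly many small subtrees in
`eventually_treeMean_minExp_le`. -/
theorem treeMean_minExp_le (m n : ℕ) :
    treeMean n (minExp m) ≤ Real.exp 512 * 6 ^ m := by
  induction m generalizing n with
  | zero =>
    have := treeMean_exp_zeta_le n (x := 1) (by norm_num) le_rfl
    simpa [minExp] using this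
  | succ m ih =>
    cases n with
    | zero =>
      rw [treeMean_zero, minExp]
      exact one_le_mul_of_one_le_of_one_le (Real.one_le_exp (by norm_num))
        (one_le_pow₀ (by norm_num))
    | succ n =>
      refine (treeMean_minExp_succ_le m n).trans ?_
      calc _ ≤ 2 * Real.exp 1 / ((n + 1) * (n + 2) ^ 2) * ∑ ij ∈ antidiagonal n,
            ((ij.1 : ℝ) + 1) * (ij.2 + 1) * (Real.exp 512 * 6 ^ m) := by
            gcongr with ij _
            exact ih ij.1
        _ = Real.exp 1 * (((n : ℝ) + 3) / (3 * (n + 2))) * (Real.exp 512 * 6 ^ m) := by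
          rw [← Finset.sum_mul, sum_antidiagonal_mul]
          field_simp
          ring
        _ ≤ 6 * (Real.exp 512 * 6 ^ m) := by
          gcongr
          have h1 : ((n : ℝ) + 3) / (3 * (n + 2)) ≤ 1 := by
            rw [div_le_one (by positivity)]; linarith
          have h2 := Real.exp_one_lt_d9
          have h3 : 0 < ((n : ℝ) + 3) / (3 * (n + 2)) := by positivity
          nlinarith
        _ = _ := by ring

/-- The decay can only hold for large `n`, since an empty tree has `minExp` equal to `1` at every
positive level. Small left subtrees contribute `O(1 / n)`; for the others the limiting contraction
factor is `e / 3`. -/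
theorem eventually_treeMean_minExp_le (m : ℕ) :
    ∀ᶠ n in atTop, treeMean n (minExp m) ≤ Real.exp 512 * (19 / 20) ^ m := by
  induction m with
  | zero => exact Eventually.of_forall fun n => by simpa using treeMean_minExp_le 0 n
  | succ m ih =>
    obtain ⟨N, hN⟩ := eventually_atTop.1 ih
    set A := Real.exp 512 * 6 ^ m with hA
    set B := Real.exp 512 * (19 / 20 : ℝ) ^ m with hB
    have hA0 : 0 < A := by positivity
    have hB0 : 0 < B := by positivity
    have key : ∀ n : ℕ, treeMean (n + 1) (minExp (m + 1)) ≤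
        2 * Real.exp 1 * A * N / (n + 1) + Real.exp 1 / 3 * B * (1 + 1 / (n + 2)) := by
      intro n
      refine (treeMean_minExp_succ_le m n).trans ?_
      -- Below the threshold `N` of the induction hypothesis the crude bound `A` is used, above it
      -- the good bound `B`.
      have h1 : ∑ ij ∈ antidiagonal n, ((ij.1 : ℝ) + 1) * (ij.2 + 1) * treeMean ij.1 (minExp m) ≤
          ∑ ij ∈ antidiagonal n, ((if ij.1 < N then (n + 2) ^ 2 * A else 0) +
            ((ij.1 : ℝ) + 1) * (ij.2 + 1) * B) := by
        refine Finset.sum_le_sum fun ij hij => ?_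
        have hij : (ij.1 : ℝ) + ij.2 = n := by exact_mod_cast mem_antidiagonal.1 hij
        have h0 : 0 ≤ treeMean ij.1 (minExp m) := treeMean_nonneg fun t => (minExp_pos m t).le
        split_ifs with h
        · have h2 : ((ij.1 : ℝ) + 1) * (ij.2 + 1) ≤ (n + 2) ^ 2 := by
            have : (0 : ℝ) ≤ ij.1 := by positivity
            have : (0 : ℝ) ≤ ij.2 := by positivity
            nlinarith
          have h3 := mul_le_mul h2 (treeMean_minExp_le m ij.1) h0 (by positivity)
          have h4 : 0 ≤ ((ij.1 : ℝ) + 1) * (ij.2 + 1) * B := by positivity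
          linarith
        · rw [zero_add]
          exact mul_le_mul_of_nonneg_left (hN _ (not_lt.1 h)) (by positivity)
      have h2 : ∑ ij ∈ antidiagonal n, (if ij.1 < N then ((n : ℝ) + 2) ^ 2 * A else 0) ≤
          N * ((n + 2) ^ 2 * A) := by
        rw [sum_antidiagonal_fst n fun i => if i < N then ((n : ℝ) + 2) ^ 2 * A else 0,
          ← Finset.sum_filter, Finset.sum_const, nsmul_eq_mul]
        gcongr
        exact (Finset.card_le_card fun i hi => by
          simp only [Finset.mem_filter] at hi; exact Finset.mem_range.2 hi.2).trans_eq
            (Finset.card_range N)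
      rw [Finset.sum_add_distrib, ← Finset.sum_mul, sum_antidiagonal_mul] at h1
      calc _ ≤ 2 * Real.exp 1 / ((n + 1) * (n + 2) ^ 2) *
            (N * ((n + 2) ^ 2 * A) + (n + 1) * (n + 2) * (n + 3) / 6 * B) := by
            gcongr
            linarith
        _ = _ := by
          field_simp
          ring
    have hlim : Tendsto (fun n : ℕ => 2 * Real.exp 1 * A * N / ((n : ℝ) + 1) +
        Real.exp 1 / 3 * B * (1 + 1 / ((n : ℝ) + 2))) atTop (𝓝 (0 + Real.exp 1 / 3 * B * (1 + 0))) := by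
      have h1 : Tendsto (fun n : ℕ => (n : ℝ) + 1) atTop atTop :=
        tendsto_atTop_add_const_right _ _ tendsto_natCast_atTop_atTop
      have h2 : Tendsto (fun n : ℕ => (n : ℝ) + 2) atTop atTop :=
        tendsto_atTop_add_const_right _ _ tendsto_natCast_atTop_atTop
      exact (tendsto_const_nhds.div_atTop h1).add
        (tendsto_const_nhds.mul (tendsto_const_nhds.add (tendsto_const_nhds.div_atTop h2)))
    -- This holds because `e / 3 < 0.907 < 19 / 20`.
    have hlt : 0 + Real.exp 1 / 3 * B * (1 + 0) < Real.exp 512 * (19 / 20) ^ (m + 1) := by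
      have := Real.exp_one_lt_d9
      have h : Real.exp 512 * (19 / 20 : ℝ) ^ (m + 1) = B * (19 / 20) := by
        rw [hB, pow_succ]; ring
      rw [h]
      nlinarith
    have := (hlim.eventually_lt_const hlt).mono fun n hn => (key n).trans hn.le
    obtain ⟨K, hK⟩ := eventually_atTop.1 this
    refine eventually_atTop.2 ⟨K + 1, fun n hn => ?_⟩
    obtain ⟨n, rfl⟩ : ∃ k, n = k + 1 := ⟨n - 1, by omega⟩
    exact hK n (by omega)

/-! ### The silhouette of a tree in terms of its two subtrees -/

/-- The set of nodes of a tree shape. -/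
def nodeSet : BinaryTree Unit → Finset (List Bool)
  | .nil => ∅
  | .node _ l r => {[]} ∪ (nodeSet l).image (List.cons false) ∪ (nodeSet r).image (List.cons true)

theorem nil_mem_nodeSet (l r : BinaryTree Unit) : [] ∈ nodeSet (.node () l r) := by
  simp [nodeSet]

theorem cons_mem_nodeSet (b : Bool) (w : List Bool) (l r : BinaryTree Unit) :
    b :: w ∈ nodeSet (.node () l r) ↔ w ∈ nodeSet (child b l r) := by
  cases b <;> simp [nodeSet, child]

theorem card_nodeSet : ∀ t, (nodeSet t).card = t.numNodes
  | .nil => rfl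
  | .node _ l r => by
    rw [nodeSet, Finset.card_union_of_disjoint, Finset.card_union_of_disjoint,
      Finset.card_image_of_injective _ List.cons_injective,
      Finset.card_image_of_injective _ List.cons_injective, card_nodeSet l, card_nodeSet r,
      Finset.card_singleton, BinaryTree.numNodes]
    · ring
    · simp
    · rw [Finset.disjoint_left]
      intro w hw hw'
      simp only [Finset.mem_union, Finset.mem_singleton, Finset.mem_image] at hw hw'
      obtain ⟨u, _, rfl⟩ := hw'
      simp at hw

/-- The numerical value of a binary digit. -/
def bit (b : Bool) : ℝ := if b then 1 else 0

theorem digit_zero {b : Bool} {s : ℝ} (h : s ∈ Set.Ico (bit b / 2) ((1 + bit b) / 2)) :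
    digit s 0 = b := by
  have h1 : s ≠ 1 := by
    rintro rfl
    cases b <;> (simp [bit] at h; try linarith)
  rw [digit, if_neg h1, zero_add, pow_one]
  cases b
  · simp only [bit, Bool.false_eq_true, if_false, Set.mem_Ico] at h
    have : ⌊2 * s⌋ = 0 := Int.floor_eq_iff.2 ⟨by push_cast; linarith, by push_cast; linarith⟩
    simp [this]
  · simp only [bit, if_true, Set.mem_Ico] at h
    have : ⌊2 * s⌋ = 1 := Int.floor_eq_iff.2 ⟨by push_cast; linarith, by push_cast; linarith⟩
    simp [this]

/-- On the half-open half interval neither `s` nor `2 * s - bit b` equals `1`, so the special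
convention for the digits of `1` plays no role. -/
theorem digit_succ {b : Bool} {s : ℝ} (h : s ∈ Set.Ico (bit b / 2) ((1 + bit b) / 2)) (i : ℕ) :
    digit s (i + 1) = digit (2 * s - bit b) i := by
  have h1 : s ≠ 1 := by
    rintro rfl
    cases b <;> (simp [bit] at h; try linarith)
  have h2 : 2 * s - bit b ≠ 1 := by
    have := h.2
    intro h3
    linarith
  rw [digit, if_neg h1, digit, if_neg h2]
  cases b
  · simp only [bit, Bool.false_eq_true, if_false, sub_zero]
    rw [pow_succ _ (i + 1), mul_assoc]
  · have : (2 : ℝ) ^ (i + 1) * (2 * s - bit true) =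
        2 ^ (i + 1 + 1) * s - ((2 ^ (i + 1) : ℤ) : ℝ) := by
      simp only [bit, if_true]
      push_cast
      ring
    rw [this, Int.floor_sub_intCast]
    congr 2
    rw [pow_succ]
    omega

theorem pathNode_succ {b : Bool} {s : ℝ} (h : s ∈ Set.Ico (bit b / 2) ((1 + bit b) / 2)) (k : ℕ) :
    pathNode s (k + 1) = b :: pathNode (2 * s - bit b) k := by
  rw [pathNode, List.ofFn_succ, pathNode]
  congr 1
  · exact digit_zero h
  · congr 1
    funext i
    exact digit_succ h i

/-- Nonemptiness of `B` excludes the default value `sInf ∅ = 0`. -/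
theorem sInf_eq_succ {A B : Set ℕ} (h0 : 0 ∉ A) (h : ∀ k, k + 1 ∈ A ↔ k ∈ B) (hB : B.Nonempty) :
    sInf A = sInf B + 1 := by
  refine le_antisymm (Nat.sInf_le ((h _).2 (Nat.sInf_mem hB))) ?_
  have hA : sInf A ∈ A := Nat.sInf_mem ⟨_, (h _).2 hB.some_mem⟩
  cases hk : sInf A with
  | zero => rw [hk] at hA; exact absurd hA h0
  | succ k =>
    rw [hk] at hA
    have := Nat.sInf_le ((h k).1 hA)
    omega

theorem silhouette_node {b : Bool} {s : ℝ} (h : s ∈ Set.Ico (bit b / 2) ((1 + bit b) / 2))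
    (l r : BinaryTree Unit) :
    silhouette (nodeSet (.node () l r)) s =
      silhouette (nodeSet (child b l r)) (2 * s - bit b) + 1 := by
  refine sInf_eq_succ ?_ (fun k => ?_) ?_
  · simpa [pathNode] using nil_mem_nodeSet l r
  · simp only [Set.mem_ofPred_eq, pathNode_succ h, cons_mem_nodeSet]
  · obtain ⟨K, hK⟩ := exists_pathNode_notMem (nodeSet (child b l r))
    exact ⟨K, hK _⟩

theorem silhouette_nil (s : ℝ) : silhouette (nodeSet .nil) s = 0 :=
  Nat.sInf_eq_zero.2 (Or.inl (by simp [nodeSet]))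

/-- Substitution `u = 2 * s - bit b` in `silhouette_node`; passing to the open interval discards the
endpoint `(1 + bit b) / 2`, where that identity is not available. -/
theorem integral_silhouette_node {b : Bool} {x y : ℝ} (hx : 0 ≤ x) (hxy : x ≤ y) (hy : y ≤ 1)
    (l r : BinaryTree Unit) :
    ∫ s in (bit b + x) / 2..(bit b + y) / 2, (silhouette (nodeSet (.node () l r)) s : ℝ) =
      (y - x) / 2 + (∫ s in x..y, (silhouette (nodeSet (child b l r)) s : ℝ)) / 2 := by
  have h1 : ∫ s in (bit b + x) / 2..(bit b + y) / 2,
      (silhouette (nodeSet (.node () l r)) s : ℝ) =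
      ∫ s in (bit b + x) / 2..(bit b + y) / 2,
        ((fun u => (silhouette (nodeSet (child b l r)) u : ℝ) + 1) (2 * s - bit b)) := by
    rw [intervalIntegral.integral_of_le (by linarith), intervalIntegral.integral_of_le (by linarith),
      integral_Ioc_eq_integral_Ioo, integral_Ioc_eq_integral_Ioo]
    refine setIntegral_congr_fun measurableSet_Ioo fun s hs => ?_
    have : s ∈ Set.Ico (bit b / 2) ((1 + bit b) / 2) :=
      ⟨by linarith [hs.1], by linarith [hs.2]⟩
    simp only [silhouette_node this]
    push_cast
    rfl
  rw [h1, intervalIntegral.integral_comp_mul_sub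
      (fun u => (silhouette (nodeSet (child b l r)) u : ℝ) + 1) two_ne_zero (bit b),
    show 2 * ((bit b + x) / 2) - bit b = x by ring, show 2 * ((bit b + y) / 2) - bit b = y by ring,
    intervalIntegral.integral_add (intervalIntegrable_silhouette _ _ _) intervalIntegrable_const]
  simp only [intervalIntegral.integral_const, smul_eq_mul]
  ring

theorem integral_silhouette_nil (x y : ℝ) :
    ∫ s in x..y, (silhouette (nodeSet .nil) s : ℝ) = 0 := by
  simp [silhouette_nil]

/-- Justifies the recursive definition of `zeta`: `toll` is what remains at the root after centering
the tree and both subtrees by their harmonic numbers. -/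
theorem integral_silhouette_eq_zeta : ∀ t : BinaryTree Unit,
    ∫ s in (0 : ℝ)..1, (silhouette (nodeSet t) s : ℝ) = harm t.numNodes + zeta t
  | .nil => by simp [integral_silhouette_nil, harm_zero, zeta]
  | .node _ l r => by
    have h0 := integral_silhouette_node (b := false) (x := 0) (y := 1) le_rfl zero_le_one le_rfl l r
    have h1 := integral_silhouette_node (b := true) (x := 0) (y := 1) le_rfl zero_le_one le_rfl l r
    simp only [bit, child, Bool.false_eq_true, if_false, if_true,
      integral_silhouette_eq_zeta l, integral_silhouette_eq_zeta r] at h0 h1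
    norm_num at h0 h1
    rw [← intervalIntegral.integral_add_adjacent_intervals (b := 1 / 2)
      (intervalIntegrable_silhouette _ _ _) (intervalIntegrable_silhouette _ _ _), h0, h1, zeta, toll,
      BinaryTree.numNodes]
    ring

/-! ### Dyadic intervals and increments -/

/-- The left endpoint of the dyadic interval that belongs to a node. -/
def left : List Bool → ℝ
  | [] => 0
  | b :: w => (bit b + left w) / 2

theorem left_mem : ∀ v : List Bool, 0 ≤ left v ∧ left v + (1 / 2) ^ v.length ≤ 1
  | [] => by simp [left]
  | b :: w => by
    obtain ⟨h1, h2⟩ := left_mem w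
    rw [left, List.length_cons, pow_succ]
    cases b <;> simp only [bit, Bool.false_eq_true, if_false, if_true] <;>
      constructor <;> linarith

theorem integral_silhouette_left (v : List Bool) (t : BinaryTree Unit) :
    (2 : ℝ) ^ v.length *
      ∫ s in left v..left v + (1 / 2) ^ v.length, (silhouette (nodeSet t) s : ℝ) =
      harm t.numNodes + incr v t := by
  induction v generalizing t with
  | nil => simpa [left, incr] using integral_silhouette_eq_zeta t
  | cons b w ih =>
    cases t with
    | nil => rw [integral_silhouette_nil, incr, BinaryTree.numNodes, harm_zero]; ring
    | node _ l r =>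
      obtain ⟨h1, h2⟩ := left_mem w
      have h3 : (0 : ℝ) ≤ (1 / 2) ^ w.length := by positivity
      have h4 := integral_silhouette_node (b := b) h1 (by linarith) h2 l r
      have h5 : left (b :: w) + (1 / 2) ^ (b :: w).length =
          (bit b + (left w + (1 / 2) ^ w.length)) / 2 := by
        rw [left, List.length_cons, pow_succ]; ring
      have h6 : (2 : ℝ) ^ w.length * (1 / 2) ^ w.length = 1 := by
        rw [← mul_pow]; norm_num
      rw [h5, left, h4, incr, slope, List.length_cons, pow_succ, BinaryTree.numNodes]
      have := ih (child b l r)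
      linear_combination this + h6

/-- The left endpoint of a dyadic interval, as element of the unit interval. -/
def leftI (v : List Bool) : I :=
  ⟨left v, (left_mem v).1, by
    have := (left_mem v).2
    have h : (0 : ℝ) ≤ (1 / 2) ^ v.length := by positivity
    linarith⟩

/-- The right endpoint of a dyadic interval, as element of the unit interval. -/
def rightI (v : List Bool) : I :=
  ⟨left v + (1 / 2) ^ v.length, by
    have := (left_mem v).1
    positivity, (left_mem v).2⟩

/-- The difference quotient over the dyadic interval of `v` of the function `t ↦ Y(t) + t ζ`,
for a point `(Y, ζ)` of the state space. -/
def quotient (v : List Bool) (z : StateSpace) : ℝ :=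
  2 ^ v.length * ((z.1 : C(I, ℝ)) (rightI v) - (z.1 : C(I, ℝ)) (leftI v)) + z.2

theorem continuous_quotient (v : List Bool) : Continuous (quotient v) := by
  have h : ∀ x : I, Continuous fun z : StateSpace => (z.1 : C(I, ℝ)) x := fun x =>
    (continuous_eval_const x).comp (continuous_subtype_val.comp continuous_fst)
  exact (continuous_const.mul ((h _).sub (h _))).add continuous_snd

theorem quotient_nil (z : StateSpace) : quotient [] z = z.2 := by
  have h0 : leftI [] = 0 := by ext; simp [leftI, left]
  have h1 : rightI [] = 1 := by ext; simp [rightI, left]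
  rw [quotient, h0, h1, z.1.2.1, z.1.2.2]
  simp

/-- The normalized integrated silhouette and the centered path length of a tree shape. -/
def stateOf (t : BinaryTree Unit) : StateSpace :=
  (normalizedSilhouette (nodeSet t), centeredPathLength (nodeSet t))

/-- The normalization subtracts the total integral from the difference quotient and the second
coordinate adds it back, so only the harmonic centering is left. -/
theorem quotient_stateOf (v : List Bool) (t : BinaryTree Unit) :
    quotient v (stateOf t) = incr v t := by
  have h := integral_silhouette_left v t
  have h2 := intervalIntegral.integral_interval_sub_left
    (intervalIntegrable_silhouette (nodeSet t) 0 (left v + (1 / 2) ^ v.length))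
    (intervalIntegrable_silhouette (nodeSet t) 0 (left v))
  have h6 : (2 : ℝ) ^ v.length * (1 / 2) ^ v.length = 1 := by
    rw [← mul_pow]; norm_num
  rw [← h2, ← integratedSilhouette, ← integratedSilhouette] at h
  simp only [quotient, stateOf, normalizedSilhouette, centeredPathLength, pathLength,
    ContinuousMap.coe_mk, leftI, rightI, card_nodeSet]
  change _ + (_ - harm t.numNodes) = _
  linear_combination h - h6 * integratedSilhouette (nodeSet t) 1

/-- The shape of a labeled tree. -/
def LabeledTree.shape : LabeledTree → BinaryTree Unit
  | .empty => .nil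
  | .node _ l r => .node () l.shape r.shape

theorem nodeSet_shape : ∀ T : LabeledTree, nodeSet T.shape = T.nodes
  | .empty => rfl
  | .node _ l r => by
    rw [LabeledTree.shape, nodeSet, LabeledTree.nodes, nodeSet_shape l, nodeSet_shape r]

theorem Z_eq_stateOf (x : ℕ → ℝ) (n : ℕ) : Z x n = stateOf (labeledBST x n).shape := by
  rw [Z, stateOf, nodeSet_shape, bst]

/-! ### From dyadic increments to the modulus of continuity -/

theorem natFloor_pow_succ_div_two (t : ℝ) (n : ℕ) :
    ⌊(2 : ℝ) ^ (n + 1) * t⌋₊ / 2 = ⌊(2 : ℝ) ^ n * t⌋₊ := by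
  have := Nat.floor_div_natCast ((2 : ℝ) ^ (n + 1) * t) 2
  rw [← this]
  congr 1
  push_cast
  ring

theorem natFloor_pow_mul_le {t : ℝ} (ht : t ≤ 1) (n : ℕ) : ⌊(2 : ℝ) ^ n * t⌋₊ ≤ 2 ^ n := by
  refine Nat.floor_le_of_le ?_
  push_cast
  have : (0 : ℝ) < 2 ^ n := by positivity
  nlinarith

/-- Chaining along the dyadic approximations of `t` from below: from one level to the next the point
stays (even numerator) or moves right by one dyadic step (odd numerator), and the bounds form a
geometric series. -/
theorem abs_sub_dyadic_le {f : ℝ → ℝ} (hf : Continuous f) {C r : ℝ} (hC : 0 ≤ C) (hr : 0 < r)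
    (hr1 : r < 1)
    (h : ∀ n j : ℕ, j < 2 ^ n → |f ((j + 1 : ℕ) / 2 ^ n) - f ((j : ℕ) / 2 ^ n)| ≤ C * r ^ n)
    {t : ℝ} (ht0 : 0 ≤ t) (ht : t ≤ 1) (n : ℕ) :
    |f (⌊(2 : ℝ) ^ n * t⌋₊ / 2 ^ n) - f t| ≤ C * r ^ n * (r / (1 - r)) := by
  have hlim : Tendsto (fun n : ℕ => (⌊(2 : ℝ) ^ n * t⌋₊ : ℝ) / 2 ^ n) atTop (𝓝 t) := by
    have h1 := (tendsto_nat_floor_mul_div_atTop (R := ℝ) ht0).comp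
      (tendsto_pow_atTop_atTop_of_one_lt (one_lt_two (α := ℝ)))
    refine h1.congr fun n => ?_
    simp only [Function.comp_apply, mul_comm t]
  have hd := dist_le_of_le_geometric_of_tendsto r (C * r) hr1 (fun n => ?_)
    ((hf.tendsto t).comp hlim) n
  · rw [Real.dist_eq] at hd
    refine hd.trans_eq ?_
    ring
  · rw [Real.dist_eq, abs_sub_comm]
    simp only [Function.comp_apply]
    have h1 := natFloor_pow_succ_div_two t n
    have h2 := natFloor_pow_mul_le ht (n + 1)
    have h0 : 0 ≤ C * r * r ^ n := by positivity
    rcases Nat.even_or_odd' ⌊(2 : ℝ) ^ (n + 1) * t⌋₊ with ⟨k, hk | hk⟩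
    · rw [hk] at h1 ⊢
      rw [← h1, Nat.mul_div_cancel_left k two_pos]
      have : ((2 * k : ℕ) : ℝ) / 2 ^ (n + 1) = (k : ℝ) / 2 ^ n := by
        push_cast; field_simp; ring
      rw [this, sub_self, abs_zero]
      exact h0
    · rw [hk] at h1 h2 ⊢
      rw [← h1, show (2 * k + 1) / 2 = k by omega]
      have h3 := h (n + 1) (2 * k) (by omega)
      have : ((2 * k : ℕ) : ℝ) / 2 ^ (n + 1) = (k : ℝ) / 2 ^ n := by
        push_cast; field_simp; ring
      rw [this] at h3
      refine h3.trans_eq ?_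
      ring

theorem abs_sub_le_of_dyadic {f : ℝ → ℝ} (hf : Continuous f) {C r : ℝ} (hC : 0 ≤ C) (hr : 0 < r)
    (hr1 : r < 1)
    (h : ∀ n j : ℕ, j < 2 ^ n → |f ((j + 1 : ℕ) / 2 ^ n) - f ((j : ℕ) / 2 ^ n)| ≤ C * r ^ n)
    {s t : ℝ} (hs : 0 ≤ s) (hst : s ≤ t) (ht : t ≤ 1) (n : ℕ) (hn : t - s ≤ (1 / 2) ^ n) :
    |f t - f s| ≤ C * (2 / (1 - r)) * r ^ n := by
  have h1 := abs_sub_dyadic_le hf hC hr hr1 h hs (hst.trans ht) n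
  have h2 := abs_sub_dyadic_le hf hC hr hr1 h (hs.trans hst) ht n
  have hpow : (2 : ℝ) ^ n * (1 / 2) ^ n = 1 := by rw [← mul_pow]; norm_num
  have h2n : (0 : ℝ) < 2 ^ n := by positivity
  have h3 : |f (⌊(2 : ℝ) ^ n * t⌋₊ / 2 ^ n) - f (⌊(2 : ℝ) ^ n * s⌋₊ / 2 ^ n)| ≤ C * r ^ n := by
    have hle : ⌊(2 : ℝ) ^ n * s⌋₊ ≤ ⌊(2 : ℝ) ^ n * t⌋₊ :=
      Nat.floor_mono (mul_le_mul_of_nonneg_left hst h2n.le)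
    have hle' : ⌊(2 : ℝ) ^ n * t⌋₊ ≤ ⌊(2 : ℝ) ^ n * s⌋₊ + 1 := by
      rw [← Nat.floor_add_one (by positivity)]
      refine Nat.floor_mono ?_
      nlinarith
    rcases Nat.le_and_le_add_one_iff.1 ⟨hle, hle'⟩ with heq | heq
    · rw [heq, sub_self, abs_zero]; positivity
    · rw [heq]
      refine h n _ ?_
      have := natFloor_pow_mul_le ht n
      omega
  have hr' : 0 < 1 - r := by linarith
  -- The chain needs only the first three summands; the last one is slack that keeps the constant
  -- short.
  have h4 : C * (2 / (1 - r)) * r ^ n =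
      C * r ^ n + C * r ^ n * (r / (1 - r)) + C * r ^ n * (r / (1 - r)) + C * r ^ n := by
    field_simp
    ring
  have h5 : 0 ≤ C * r ^ n := by positivity
  have h6 : f t - f s = (f (⌊(2 : ℝ) ^ n * t⌋₊ / 2 ^ n) - f (⌊(2 : ℝ) ^ n * s⌋₊ / 2 ^ n)) +
      (f (⌊(2 : ℝ) ^ n * s⌋₊ / 2 ^ n) - f s) - (f (⌊(2 : ℝ) ^ n * t⌋₊ / 2 ^ n) - f t) := by ring
  rw [h6, h4]
  refine (abs_sub _ _).trans ?_
  refine (add_le_add_left (abs_add_le _ _) _).trans ?_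
  linarith

theorem exists_left_eq (n j : ℕ) (hj : j < 2 ^ n) :
    ∃ v : List Bool, v.length = n ∧ left v = (j : ℝ) / 2 ^ n := by
  induction n generalizing j with
  | zero =>
    obtain rfl : j = 0 := by simpa using hj
    exact ⟨[], rfl, by simp [left]⟩
  | succ n ih =>
    rcases lt_or_ge j (2 ^ n) with h | h
    · obtain ⟨v, hv, hv'⟩ := ih j h
      refine ⟨false :: v, by simp [hv], ?_⟩
      rw [left, hv', bit, if_neg (by simp), pow_succ]
      field_simp
      ring
    · obtain ⟨v, hv, hv'⟩ := ih (j - 2 ^ n) (by rw [pow_succ] at hj; omega)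
      refine ⟨true :: v, by simp [hv], ?_⟩
      rw [left, hv', bit, if_pos rfl, Nat.cast_sub h, pow_succ]
      push_cast
      field_simp
      ring

/-! ### Regularity and compactness on the sets `good M` -/

/-- The states whose dyadic difference quotients grow at most linearly with the level. -/
def good (M : ℝ) : Set StateSpace :=
  {z | ∀ v : List Bool, Real.exp (|quotient v z| / 4) ≤ M * 32 ^ v.length}

theorem isClosed_good (M : ℝ) : IsClosed (good M) := by
  have : good M = ⋂ v : List Bool, {z | Real.exp (|quotient v z| / 4) ≤ M * 32 ^ v.length} := by
    ext z; simp [good]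
  rw [this]
  refine isClosed_iInter fun v => isClosed_le ?_ continuous_const
  have := continuous_quotient v
  fun_prop

/-- The first component of a state, as a continuous function on the real line. -/
def extend (z : StateSpace) (x : ℝ) : ℝ := (z.1 : C(I, ℝ)) (Set.projIcc 0 1 zero_le_one x)

theorem continuous_extend (z : StateSpace) : Continuous (extend z) :=
  (z.1 : C(I, ℝ)).continuous.comp continuous_projIcc

theorem extend_coe (z : StateSpace) (t : I) : extend z t = (z.1 : C(I, ℝ)) t := by
  rw [extend, Set.projIcc_val]

theorem extend_sub_eq_quotient {n j : ℕ} {v : List Bool} (hv : v.length = n)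
    (hv' : left v = (j : ℝ) / 2 ^ n) (z : StateSpace) :
    extend z ((j + 1 : ℕ) / 2 ^ n) - extend z ((j : ℕ) / 2 ^ n) =
      (1 / 2) ^ n * (quotient v z - z.2) := by
  have h1 : ((j : ℕ) : ℝ) / 2 ^ n = leftI v := hv'.symm
  have h2 : ((j + 1 : ℕ) : ℝ) / 2 ^ n = rightI v := by
    simp only [rightI, hv', hv]
    push_cast
    rw [one_div_pow]
    ring
  have hpow : ((1 / 2) : ℝ) ^ n * 2 ^ n = 1 := by rw [← mul_pow]; norm_num
  rw [h1, h2, extend_coe, extend_coe, quotient, hv]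
  linear_combination (-(z.1 : C(I, ℝ)) (rightI v) + (z.1 : C(I, ℝ)) (leftI v)) * hpow

theorem abs_quotient_le_of_mem_good {M : ℝ} {z : StateSpace} (hz : z ∈ good M) (v : List Bool) :
    |quotient v z| ≤ 4 * (Real.log M + v.length * Real.log 32) := by
  have h := hz v
  have hM : 0 < M := by
    have : 0 < M * 32 ^ v.length := (Real.exp_pos _).trans_le h
    exact pos_of_mul_pos_left this (by positivity)
  have h2 := (Real.le_log_iff_exp_le (by positivity)).2 h
  rw [Real.log_mul hM.ne' (by positivity), Real.log_pow] at h2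
  linarith

/-- Linear growth in the level is absorbed by any rate `r > 1 / 2`, since `n * (1 / (2 * r)) ^ n` is
bounded. The `8` in `A` accounts for `log M` twice: once for `quotient v z` and once for `z.2`,
which is the quotient of the empty word. -/
theorem exists_dyadic_bound_of_good (M : ℝ) {r : ℝ} (hr : 1 / 2 < r) :
    ∃ C : ℝ, 0 ≤ C ∧ ∀ z ∈ good M, ∀ n j : ℕ, j < 2 ^ n →
      |extend z ((j + 1 : ℕ) / 2 ^ n) - extend z ((j : ℕ) / 2 ^ n)| ≤ C * r ^ n := by
  set A := 8 * Real.log M with hA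
  set B := 4 * Real.log 32 with hB
  have hr0 : 0 < r := by linarith
  have hq1 : 1 / (2 * r) < 1 := by rw [div_lt_one (by positivity)]; linarith
  have hq0 : 0 ≤ 1 / (2 * r) := by positivity
  have hlim : Tendsto (fun n : ℕ => A * (1 / (2 * r)) ^ n + B * (n * (1 / (2 * r)) ^ n))
      atTop (𝓝 (A * 0 + B * 0)) :=
    ((tendsto_pow_atTop_nhds_zero_of_lt_one hq0 hq1).const_mul A).add
      ((tendsto_self_mul_const_pow_of_lt_one hq0 hq1).const_mul B)
  obtain ⟨C, hC⟩ := hlim.bddAbove_range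
  refine ⟨max C 0, le_max_right _ _, fun z hz n j hj => ?_⟩
  obtain ⟨v, hv, hv'⟩ := exists_left_eq n j hj
  rw [extend_sub_eq_quotient hv hv', abs_mul, abs_of_nonneg (by positivity)]
  have h1 := abs_quotient_le_of_mem_good hz v
  have h2 := abs_quotient_le_of_mem_good hz []
  rw [quotient_nil] at h2
  simp only [List.length_nil, Nat.cast_zero, zero_mul, add_zero] at h2
  rw [hv] at h1
  have h3 : |quotient v z - z.2| ≤ A + B * n := (abs_sub _ _).trans (by rw [hA, hB]; linarith)
  have h4 : A * (1 / (2 * r)) ^ n + B * (n * (1 / (2 * r)) ^ n) ≤ C := hC ⟨n, rfl⟩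
  have h5 : (1 / 2 : ℝ) ^ n = (1 / (2 * r)) ^ n * r ^ n := by
    rw [← mul_pow]; congr 1; field_simp
  calc _ ≤ (1 / 2 : ℝ) ^ n * (A + B * n) := by gcongr
    _ = (A * (1 / (2 * r)) ^ n + B * (n * (1 / (2 * r)) ^ n)) * r ^ n := by rw [h5]; ring
    _ ≤ _ := by gcongr; exact h4.trans (le_max_left _ _)

theorem holderSup_lt_top_of_mem_good {M : ℝ} {z : StateSpace} (hz : z ∈ good M) {α : ℝ}
    (hα : α < 1) : holderSup α (z.1 : C(I, ℝ)) < ∞ := by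
  -- The exponent is made positive, so that `r = (1 / 2) ^ β` lies strictly between `1 / 2` and `1`;
  -- on differences at most `1` this only strengthens the claim.
  set β := max α (1 / 2) with hβ
  have hβ1 : β < 1 := max_lt hα (by norm_num)
  have hβ0 : 0 < β := lt_of_lt_of_le (by norm_num) (le_max_right _ _)
  set r : ℝ := (1 / 2 : ℝ) ^ β with hr
  have hr1 : r < 1 := Real.rpow_lt_one (by norm_num) (by norm_num) hβ0
  have hr2 : 1 / 2 < r := by
    have := Real.rpow_lt_rpow_of_exponent_gt (x := 1 / 2) (by norm_num) (by norm_num) hβ1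
    rwa [Real.rpow_one] at this
  obtain ⟨C, hC, h⟩ := exists_dyadic_bound_of_good M hr2
  have hr' : 0 < 1 - r := by linarith
  refine lt_of_le_of_lt (b := ENNReal.ofReal (C * (2 / (1 - r)) * 2)) ?_ ENNReal.ofReal_lt_top
  refine iSup_le fun s => iSup_le fun t => iSup_le fun hst => ENNReal.ofReal_le_ofReal ?_
  have hst' : (0 : ℝ) < t - s := sub_pos.2 hst
  have hts1 : (t : ℝ) - s ≤ 1 := by linarith [t.2.2, s.2.1]
  obtain ⟨n, hn1, hn2⟩ := exists_nat_pow_near_of_lt_one hst' hts1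
    (show (0 : ℝ) < 1 / 2 by norm_num) (by norm_num)
  have h1 := abs_sub_le_of_dyadic (continuous_extend z) hC (by linarith) hr1 (h z hz) s.2.1
    (Subtype.coe_le_coe.2 hst.le) t.2.2 n hn2
  rw [extend_coe, extend_coe] at h1
  rw [abs_of_pos hst', div_le_iff₀ (Real.rpow_pos_of_pos hst' _)]
  have h2 : r ^ (n + 1) ≤ ((t : ℝ) - s) ^ α := by
    calc r ^ (n + 1) = ((1 / 2 : ℝ) ^ (n + 1)) ^ β := by
          rw [hr, ← Real.rpow_natCast, ← Real.rpow_natCast, ← Real.rpow_mul (by norm_num),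
            ← Real.rpow_mul (by norm_num), mul_comm]
      _ ≤ ((t : ℝ) - s) ^ β := Real.rpow_le_rpow (by positivity) hn1.le hβ0.le
      _ ≤ _ := Real.rpow_le_rpow_of_exponent_ge hst' hts1 (le_max_left _ _)
  have h3 : r ^ n ≤ 2 * r ^ (n + 1) := by
    rw [pow_succ]
    nlinarith [pow_pos (show 0 < r by linarith) n]
  calc _ ≤ C * (2 / (1 - r)) * r ^ n := h1
    _ ≤ C * (2 / (1 - r)) * (2 * ((t : ℝ) - s) ^ α) := by
      gcongr
      linarith
    _ = _ := by ring

/-- A Lipschitz constant `L` would bound every `quotient v z` below by `-(L + |z.2|)`. -/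
theorem holderSup_one_eq_top {z : StateSpace} (h : ∀ B : ℝ, ∃ v, quotient v z < -B) :
    holderSup 1 (z.1 : C(I, ℝ)) = ∞ := by
  by_contra htop
  set L := (holderSup 1 (z.1 : C(I, ℝ))).toReal with hL
  obtain ⟨v, hv⟩ := h (L + |z.2|)
  have hlt : leftI v < rightI v := by
    rw [← Subtype.coe_lt_coe]
    simp only [leftI, rightI]
    have : (0 : ℝ) < (1 / 2) ^ v.length := by positivity
    linarith
  have h1 : ENNReal.ofReal (|(z.1 : C(I, ℝ)) (rightI v) - (z.1 : C(I, ℝ)) (leftI v)| /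
      |(rightI v : ℝ) - leftI v| ^ (1 : ℝ)) ≤ holderSup 1 (z.1 : C(I, ℝ)) :=
    le_iSup_of_le (leftI v) (le_iSup_of_le (rightI v) (le_iSup_of_le hlt le_rfl))
  have h2 := (ENNReal.ofReal_le_iff_le_toReal htop).1 h1
  have h3 : (rightI v : ℝ) - leftI v = (1 / 2) ^ v.length := by
    simp only [leftI, rightI]; ring
  rw [h3, Real.rpow_one, abs_of_pos (by positivity : (0 : ℝ) < (1 / 2) ^ v.length), one_div_pow,
    div_div_eq_mul_div, div_one, mul_comm, ← hL] at h2
  have h4 : |2 ^ v.length * ((z.1 : C(I, ℝ)) (rightI v) - (z.1 : C(I, ℝ)) (leftI v))| ≤ L := by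
    rwa [abs_mul, abs_of_pos (by positivity : (0 : ℝ) < 2 ^ v.length)]
  rw [quotient] at hv
  have h5 := neg_abs_le (2 ^ v.length * ((z.1 : C(I, ℝ)) (rightI v) - (z.1 : C(I, ℝ)) (leftI v)))
  have h6 := neg_abs_le z.2
  linarith

/-- States in `good M` share one modulus of continuity, so up to `δ` the supremum distance is
decided on one dyadic grid, hence by finitely many quotients. -/
theorem exists_dist_le_of_good (M : ℝ) {δ : ℝ} (hδ : 0 < δ) :
    ∃ n : ℕ, ∀ z ∈ good M, ∀ z' ∈ good M, ∀ ε : ℝ,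
      (∀ v : List Bool, v.length = n ∨ v = [] → |quotient v z - quotient v z'| ≤ ε) →
      dist z z' ≤ 2 * ε + δ := by
  obtain ⟨C, hC, h⟩ := exists_dyadic_bound_of_good M (r := 3 / 4) (by norm_num)
  have hlim : Tendsto (fun n : ℕ => 2 * (C * (3 / 4 : ℝ) ^ n * ((3 / 4) / (1 - 3 / 4)))) atTop
      (𝓝 (2 * (C * 0 * ((3 / 4) / (1 - 3 / 4))))) :=
    (((tendsto_pow_atTop_nhds_zero_of_lt_one (by norm_num) (by norm_num)).const_mul C).mul_const
      _).const_mul 2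
  obtain ⟨n, hn⟩ := (hlim.eventually_lt_const (u := δ) (by simpa using hδ)).exists
  refine ⟨n, fun z hz z' hz' ε hε => ?_⟩
  have hε0 : |z.2 - z'.2| ≤ ε := by
    have := hε [] (Or.inr rfl)
    rwa [quotient_nil, quotient_nil] at this
  have hεnn : 0 ≤ ε := (abs_nonneg _).trans hε0
  -- Both functions vanish at `0`, and each grid step adds at most `(1 / 2) ^ n * (2 * ε)`: one `ε`
  -- from the quotient of `v`, one from that of `[]`. Over the whole grid this stays below `2 * ε`.
  have hdy : ∀ j : ℕ, j ≤ 2 ^ n →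
      |extend z ((j : ℕ) / 2 ^ n) - extend z' ((j : ℕ) / 2 ^ n)| ≤ j * ((1 / 2) ^ n * (2 * ε)) := by
    intro j
    induction j with
    | zero =>
      intro _
      have : ∀ z : StateSpace, extend z 0 = 0 := fun z => by
        have := extend_coe z 0
        rw [z.1.2.1] at this
        simpa using this
      simp [this]
    | succ j ih =>
      intro hj
      obtain ⟨v, hv, hv'⟩ := exists_left_eq n j (by omega)
      have h1 := extend_sub_eq_quotient hv hv' z
      have h2 := extend_sub_eq_quotient hv hv' z'
      have h3 : extend z ((j + 1 : ℕ) / 2 ^ n) - extend z' ((j + 1 : ℕ) / 2 ^ n) =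
          (extend z ((j : ℕ) / 2 ^ n) - extend z' ((j : ℕ) / 2 ^ n)) +
          (1 / 2) ^ n * ((quotient v z - quotient v z') - (z.2 - z'.2)) := by
        linear_combination h1 - h2
      have h4 : |(1 / 2 : ℝ) ^ n * ((quotient v z - quotient v z') - (z.2 - z'.2))| ≤
          (1 / 2) ^ n * (2 * ε) := by
        rw [abs_mul, abs_of_pos (by positivity : (0 : ℝ) < (1 / 2) ^ n)]
        gcongr
        refine (abs_sub _ _).trans ?_
        linarith [hε v (Or.inl hv)]
      rw [h3]
      refine (abs_add_le _ _).trans ?_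
      push_cast
      linarith [ih (by omega)]
  have hpow : (2 : ℝ) ^ n * (1 / 2) ^ n = 1 := by rw [← mul_pow]; norm_num
  rw [Prod.dist_eq]
  refine max_le ?_ ?_
  · rw [Subtype.dist_eq]
    refine (ContinuousMap.dist_le (by positivity)).2 fun t => ?_
    rw [Real.dist_eq, ← extend_coe, ← extend_coe]
    set u : ℝ := (⌊(2 : ℝ) ^ n * t⌋₊ : ℝ) / 2 ^ n with hu
    have h1 : |extend z u - extend z t| ≤ _ :=
      abs_sub_dyadic_le (continuous_extend z) hC (by norm_num) (by norm_num) (h z hz) t.2.1 t.2.2 n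
    have h2 : |extend z' u - extend z' t| ≤ _ :=
      abs_sub_dyadic_le (continuous_extend z') hC (by norm_num) (by norm_num) (h z' hz')
        t.2.1 t.2.2 n
    have hfl := natFloor_pow_mul_le t.2.2 n
    have h3 := hdy _ hfl
    have h4 : (⌊(2 : ℝ) ^ n * t⌋₊ : ℝ) * ((1 / 2) ^ n * (2 * ε)) ≤ 2 * ε := by
      have h5 : (⌊(2 : ℝ) ^ n * t⌋₊ : ℝ) ≤ 2 ^ n := by exact_mod_cast hfl
      calc _ ≤ (2 : ℝ) ^ n * ((1 / 2) ^ n * (2 * ε)) := by gcongr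
        _ = _ := by rw [← mul_assoc, hpow, one_mul]
    have h6 : extend z t - extend z' t = (extend z u - extend z' u) - (extend z u - extend z t) +
        (extend z' u - extend z' t) := by ring
    rw [h6]
    refine (abs_add_le _ _).trans ((add_le_add_left (abs_sub _ _) _).trans ?_)
    linarith
  · rw [Real.dist_eq]
    linarith

/-! ### Binary search trees from lists -/

/-- The shape of the binary search tree that stores a list, for a comparison function. -/
def treeOf {α : Type*} (lt : α → α → Bool) : List α → BinaryTree Unit
  | [] => .nil
  | a :: l => .node () (treeOf lt (l.filter fun y => lt y a)) (treeOf lt (l.filter fun y => !lt y a))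
termination_by l => l.length
decreasing_by
  all_goals
    simp only [List.length_cons, List.length_unattach]
    exact Nat.lt_succ_of_le ((List.length_filter_le _ _).trans_eq List.length_attach)

theorem length_filter_add_length_filter_not {α : Type*} (p : α → Bool) (l : List α) :
    (l.filter p).length + (l.filter fun y => !p y).length = l.length := by
  induction l with
  | nil => rfl
  | cons a l ih =>
    cases h : p a <;> simp [h] <;> omega

theorem numNodes_treeOf {α : Type*} (lt : α → α → Bool) (l : List α) :
    (treeOf lt l).numNodes = l.length := by
  induction h : l.length using Nat.strong_induction_on generalizing l with
  | _ n ih =>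
    cases l with
    | nil => rw [treeOf, BinaryTree.numNodes, ← h]; rfl
    | cons a l =>
      have h1 := length_filter_add_length_filter_not (fun y => lt y a) l
      rw [List.length_cons] at h
      rw [treeOf, BinaryTree.numNodes, ih _ (by omega) _ rfl, ih _ (by omega) _ rfl]
      omega

theorem treeOf_map {α β : Type*} (lt : β → β → Bool) (f : α → β) (l : List α) :
    treeOf lt (l.map f) = treeOf (fun a b => lt (f a) (f b)) l := by
  induction h : l.length using Nat.strong_induction_on generalizing l with
  | _ n ih =>
    cases l with
    | nil => rw [List.map_nil, treeOf, treeOf]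
    | cons a l =>
      have h1 := length_filter_add_length_filter_not (fun y => lt (f y) (f a)) l
      rw [List.length_cons] at h
      rw [List.map_cons, treeOf, treeOf, List.filter_map, List.filter_map]
      congr 1
      · exact ih _ (by simp only [Function.comp_def]; omega) _ rfl
      · exact ih _ (by simp only [Function.comp_def]; omega) _ rfl

/-- Insert the elements of a list one after the other. -/
def insertAll (l : List ℝ) (T : LabeledTree) : LabeledTree := l.foldl (fun T x => T.insert x) T

/-- Each key is routed by the root label alone, so each subtree receives its keys in their original
order. This reduces iterated insertion to the quicksort-like recursion of `treeOf`. -/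
theorem insertAll_node (l : List ℝ) (a : ℝ) (L R : LabeledTree) :
    insertAll l (.node a L R) = .node a (insertAll (l.filter fun y => decide (y < a)) L)
      (insertAll (l.filter fun y => !decide (y < a)) R) := by
  induction l generalizing L R with
  | nil => rfl
  | cons x l ih =>
    rw [insertAll, List.foldl_cons, LabeledTree.insert]
    by_cases h : x < a
    · rw [if_pos h]
      refine (ih _ _).trans ?_
      simp [h, insertAll]
    · rw [if_neg h]
      refine (ih _ _).trans ?_
      simp [h, insertAll]

theorem shape_insertAll (l : List ℝ) :
    (insertAll l .empty).shape = treeOf (fun a b => decide (a < b)) l := by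
  induction h : l.length using Nat.strong_induction_on generalizing l with
  | _ n ih =>
    cases l with
    | nil => rw [treeOf]; rfl
    | cons a l =>
      have h1 := length_filter_add_length_filter_not (fun y => decide (y < a)) l
      rw [List.length_cons] at h
      have h2 : insertAll (a :: l) .empty = insertAll l (.node a .empty .empty) := rfl
      rw [h2, insertAll_node, treeOf, LabeledTree.shape, ih _ (by omega) _ rfl,
        ih _ (by omega) _ rfl]

theorem labeledBST_eq_insertAll (x : ℕ → ℝ) (n : ℕ) :
    labeledBST x n = insertAll ((List.range n).map x) .empty := by
  induction n with
  | zero => rfl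
  | succ n ih =>
    rw [labeledBST, ih, List.range_succ, List.map_append, insertAll, insertAll, List.foldl_append]
    rfl

/-- The shape depends on the values only through their pairwise comparisons, which gives
measurability and lets permutations act on the list of indices. -/
theorem shape_labeledBST (x : ℕ → ℝ) (n : ℕ) :
    (labeledBST x n).shape =
      treeOf (fun i j : Fin n => decide (x i < x j)) (List.finRange n) := by
  rw [labeledBST_eq_insertAll, shape_insertAll, treeOf_map, ← List.map_coe_finRange_eq_range,
    treeOf_map]

/-! ### Counting orderings -/

section Orderings

variable {α : Type*}

/-- All lists that enumerate a finite set without repetition. -/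
def orderings (S : Finset α) : Finset (List α) := ⟨S.val.lists, Multiset.lists_nodup_finset S⟩

theorem mem_orderings {S : Finset α} {l : List α} : l ∈ orderings S ↔ S.val = (l : Multiset α) :=
  Multiset.mem_lists_iff S.val l

theorem orderings_empty : orderings (∅ : Finset α) = {[]} := by
  ext l
  rw [mem_orderings, Finset.mem_singleton, Finset.empty_val, eq_comm, Multiset.coe_eq_zero]

theorem length_of_mem_orderings {S : Finset α} {l : List α} (h : l ∈ orderings S) :
    l.length = S.card := by
  rw [Finset.card_def, mem_orderings.1 h, Multiset.coe_card]

theorem sum_orderings [DecidableEq α] {S : Finset α} (hS : S.Nonempty) (f : List α → ℝ) :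
    ∑ l ∈ orderings S, f l = ∑ a ∈ S, ∑ l ∈ orderings (S.erase a), f (a :: l) := by
  have h : orderings S = S.biUnion fun a =>
      (orderings (S.erase a)).map ⟨List.cons a, List.cons_injective⟩ := by
    ext l
    simp only [Finset.mem_biUnion, Finset.mem_map, Function.Embedding.coeFn_mk, mem_orderings]
    constructor
    · intro hl
      cases l with
      | nil =>
        rw [Multiset.coe_nil, Finset.val_eq_zero] at hl
        exact absurd hl hS.ne_empty
      | cons a l =>
        refine ⟨a, ?_, l, ?_, rfl⟩
        · rw [← Finset.mem_val, hl]; simp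
        · rw [Finset.erase_val, hl, ← Multiset.cons_coe, Multiset.erase_cons_head]
    · rintro ⟨a, ha, l, hl, rfl⟩
      rw [← Multiset.cons_coe, ← hl, Finset.erase_val, Multiset.cons_erase ha]
  rw [h, Finset.sum_biUnion]
  · simp
  · intro a _ b _ hab
    rw [Function.onFun, Finset.disjoint_left]
    intro l hl hl'
    simp only [Finset.mem_map, Function.Embedding.coeFn_mk] at hl hl'
    obtain ⟨m, _, rfl⟩ := hl
    obtain ⟨m', _, h'⟩ := hl'
    exact hab (List.cons.inj h').1.symm

theorem card_orderings [DecidableEq α] (S : Finset α) : ((orderings S).card : ℝ) = S.card.factorial := by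
  induction h : S.card generalizing S with
  | zero => rw [Finset.card_eq_zero.1 h, orderings_empty]; simp
  | succ n ih =>
    have hS : S.Nonempty := Finset.card_pos.1 (by omega)
    have h1 := sum_orderings hS fun _ => (1 : ℝ)
    have h2 : ∀ a ∈ S, ∑ l ∈ orderings (S.erase a), (1 : ℝ) = n.factorial := by
      intro a ha
      rw [Finset.sum_const, nsmul_eq_mul, mul_one,
        ih _ (by rw [Finset.card_erase_of_mem ha]; omega)]
    rw [Finset.sum_congr rfl h2, Finset.sum_const, Finset.sum_const, nsmul_eq_mul, nsmul_eq_mul,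
      mul_one, h] at h1
    rw [h1, Nat.factorial_succ]
    push_cast
    ring

/-- Summing over all orderings of a set that is split into two parts amounts to summing over the
orderings of the parts and over their shuffles. -/
theorem sum_orderings_filter [DecidableEq α] (q : α → Bool) (f g : List α → ℝ) (S : Finset α) :
    ∑ l ∈ orderings S, f (l.filter q) * g (l.filter fun y => !q y) =
      (S.card.choose (S.filter fun y => q y = true).card : ℝ) *
        ((∑ l ∈ orderings (S.filter fun y => q y = true), f l) *
          ∑ l ∈ orderings (S.filter fun y => q y = false), g l) := by
  induction h : S.card generalizing S f g with
  | zero =>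
    rw [Finset.card_eq_zero.1 h]
    simp [orderings_empty]
  | succ n ih =>
    have hS : S.Nonempty := Finset.card_pos.1 (by omega)
    set A := S.filter fun y => q y = true with hA
    set B := S.filter fun y => q y = false with hB
    have hAB : A.card + B.card = n + 1 := by
      rw [← h, ← Finset.card_filter_add_card_filter_not (s := S) (fun y => q y = true)]
      simp [hA, hB]
    have hsplit : ∀ F : α → ℝ, ∑ a ∈ S, F a = ∑ a ∈ A, F a + ∑ a ∈ B, F a := by
      intro F
      rw [← Finset.sum_filter_add_sum_filter_not S (fun y => q y = true)]
      simp [hA, hB]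
    have hcard : ∀ a ∈ S, (S.erase a).card = n := fun a ha => by
      rw [Finset.card_erase_of_mem ha]; omega
    have h1 : ∀ a ∈ A, ∑ l ∈ orderings (S.erase a),
        f ((a :: l).filter q) * g ((a :: l).filter fun y => !q y) =
        (n.choose (A.card - 1) : ℝ) * ((∑ l ∈ orderings (A.erase a), f (a :: l)) *
          ∑ l ∈ orderings B, g l) := by
      intro a ha
      obtain ⟨haS, hqa⟩ := Finset.mem_filter.1 ha
      have h2 := ih (fun l => f (a :: l)) g (S.erase a) (hcard a haS)
      simp only [List.filter_cons, hqa, Bool.not_true, if_true, Bool.false_eq_true, if_false]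
      rw [h2, Finset.filter_erase, Finset.filter_erase, ← hA, ← hB,
        Finset.card_erase_of_mem ha, Finset.erase_eq_of_notMem (s := B) (by simp [hB, hqa])]
    have h2 : ∀ a ∈ B, ∑ l ∈ orderings (S.erase a),
        f ((a :: l).filter q) * g ((a :: l).filter fun y => !q y) =
        (n.choose A.card : ℝ) * ((∑ l ∈ orderings A, f l) *
          ∑ l ∈ orderings (B.erase a), g (a :: l)) := by
      intro a ha
      obtain ⟨haS, hqa⟩ := Finset.mem_filter.1 ha
      have h2 := ih f (fun l => g (a :: l)) (S.erase a) (hcard a haS)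
      simp only [List.filter_cons, hqa, Bool.not_false, if_true, Bool.false_eq_true, if_false]
      rw [h2, Finset.filter_erase, Finset.filter_erase, ← hA, ← hB,
        Finset.erase_eq_of_notMem (s := A) (by simp [hA, hqa])]
    rw [sum_orderings hS, hsplit, Finset.sum_congr rfl h1, Finset.sum_congr rfl h2,
      ← Finset.mul_sum, ← Finset.mul_sum, ← Finset.sum_mul, ← Finset.mul_sum]
    -- If both parts are nonempty, Pascal's rule combines the cases by whose element comes first.
    -- Empty parts are separate because decomposing by the first element requires a nonempty set.
    rcases A.eq_empty_or_nonempty with hA0 | hA0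
    · have hB0 : B.Nonempty := Finset.card_pos.1 (by rw [hA0, Finset.card_empty] at hAB; omega)
      rw [← sum_orderings hB0, hA0]
      simp
    · rcases B.eq_empty_or_nonempty with hB0 | hB0
      · rw [← sum_orderings hA0, hB0, show A.card = n + 1 by
          rw [hB0, Finset.card_empty] at hAB; omega]
        simp
      · rw [← sum_orderings hA0, ← sum_orderings hB0]
        obtain ⟨k, hk⟩ : ∃ k, A.card = k + 1 := ⟨A.card - 1, by
          have := Finset.card_pos.2 hA0; omega⟩
        rw [hk, Nat.choose_succ_succ]
        push_cast
        ring

/-- Ranks are injective with values in `range S.card`, hence a bijection; so exactly one key can be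
the root with `k` keys to its left. -/
theorem card_filter_rank_eq {S : Finset α} {x : α → ℝ} (hx : Set.InjOn x S) {k : ℕ}
    (hk : k < S.card) :
    (S.filter fun a => (S.filter fun y => x y < x a).card = k).card = 1 := by
  set rank : α → ℕ := fun a => (S.filter fun y => x y < x a).card with hrank
  have hlt : ∀ a ∈ S, ∀ b ∈ S, x a < x b → rank a < rank b := by
    intro a ha b hb hab
    refine Finset.card_lt_card ⟨fun y hy => ?_, fun h => ?_⟩
    · rw [Finset.mem_filter] at hy ⊢
      exact ⟨hy.1, hy.2.trans hab⟩
    · have := h (Finset.mem_filter.2 ⟨ha, hab⟩)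
      exact lt_irrefl _ (Finset.mem_filter.1 this).2
  have hinj : Set.InjOn rank S := by
    intro a ha b hb hab
    rcases lt_trichotomy (x a) (x b) with h | h | h
    · exact absurd hab (hlt a ha b hb h).ne
    · exact hx ha hb h
    · exact absurd hab (hlt b hb a ha h).ne'
  have himage : S.image rank = Finset.range S.card := by
    refine Finset.eq_of_subset_of_card_le (fun k hk => ?_) ?_
    · obtain ⟨a, ha, rfl⟩ := Finset.mem_image.1 hk
      refine Finset.mem_range.2 (Finset.card_lt_card ⟨Finset.filter_subset _ _, fun h => ?_⟩)
      exact lt_irrefl _ (Finset.mem_filter.1 (h ha)).2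
    · rw [Finset.card_range, Finset.card_image_of_injOn hinj]
  obtain ⟨a, ha, hak⟩ := Finset.mem_image.1 (himage ▸ Finset.mem_range.2 hk)
  rw [Finset.card_eq_one]
  refine ⟨a, ?_⟩
  ext b
  rw [Finset.mem_filter, Finset.mem_singleton]
  constructor
  · rintro ⟨hb, hbk⟩
    exact hinj hb ha (hbk.trans hak.symm)
  · rintro rfl
    exact ⟨ha, hak⟩

/-- The number of orderings of a set of keys that lead to a given shape. -/
theorem card_orderings_treeOf_eq [DecidableEq α] (t : BinaryTree Unit) {S : Finset α} {x : α → ℝ}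
    (hx : Set.InjOn x S) :
    ∑ l ∈ orderings S, (if treeOf (fun a b => decide (x a < x b)) l = t then (1 : ℝ) else 0) =
      if S.card = t.numNodes then S.card.factorial * weight t else 0 := by
  set lt : α → α → Bool := fun a b => decide (x a < x b) with hlt
  induction t generalizing S with
  | nil =>
    split_ifs with h
    · rw [BinaryTree.numNodes, Finset.card_eq_zero] at h
      rw [h, orderings_empty, Finset.sum_singleton, treeOf]
      simp [weight]
    · refine Finset.sum_eq_zero fun l hl => if_neg fun h' => h ?_
      rw [← length_of_mem_orderings hl, ← numNodes_treeOf lt, h']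
  | node u L R ihL ihR =>
    split_ifs with h
    swap
    · refine Finset.sum_eq_zero fun l hl => if_neg fun h' => h ?_
      rw [← length_of_mem_orderings hl, ← numNodes_treeOf lt, h']
    rw [BinaryTree.numNodes] at h
    set n := L.numNodes + R.numNodes with hn
    have hS : S.Nonempty := Finset.card_pos.1 (by omega)
    have h1 : ∀ a ∈ S, ∑ l ∈ orderings (S.erase a),
        (if treeOf lt (a :: l) = .node u L R then (1 : ℝ) else 0) =
        if (S.filter fun y => x y < x a).card = L.numNodes then
          n.factorial * (weight L * weight R) else 0 := by
      intro a ha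
      have hcard : (S.erase a).card = n := by rw [Finset.card_erase_of_mem ha]; omega
      have h2 : ∀ l : List α, (if treeOf lt (a :: l) = .node u L R then (1 : ℝ) else 0) =
          (fun l => if treeOf lt l = L then (1 : ℝ) else 0) (l.filter fun y => lt y a) *
          (fun l => if treeOf lt l = R then (1 : ℝ) else 0) (l.filter fun y => !lt y a) := by
        intro l
        rw [treeOf]
        simp only [BinaryTree.node.injEq, true_and, ite_and]
        split_ifs <;> simp
      rw [Finset.sum_congr rfl fun l _ => h2 l]
      refine (sum_orderings_filter (fun y => lt y a) (fun l => if treeOf lt l = L then (1 : ℝ) else 0)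
        (fun l => if treeOf lt l = R then (1 : ℝ) else 0) (S.erase a)).trans ?_
      have hA : (S.erase a).filter (fun y => lt y a = true) = S.filter fun y => x y < x a := by
        ext y
        simp only [hlt, Finset.mem_filter, Finset.mem_erase, decide_eq_true_eq]
        constructor
        · rintro ⟨⟨_, h⟩, h'⟩; exact ⟨h, h'⟩
        · rintro ⟨h, h'⟩; exact ⟨⟨fun h'' => by rw [h''] at h'; exact lt_irrefl _ h', h⟩, h'⟩
      have hAB : (S.filter fun y => x y < x a).card +
          ((S.erase a).filter fun y => lt y a = false).card = n := by
        rw [← hA, ← hcard, ← Finset.card_filter_add_card_filter_not (s := S.erase a)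
          (fun y => lt y a = true)]
        simp
      rw [hA, ihL (hx.mono (Finset.coe_subset.2 (Finset.filter_subset _ _))), ihR (hx.mono fun y hy => by
        have := Finset.mem_filter.1 hy
        exact (Finset.mem_erase.1 this.1).2), hcard]
      by_cases hL : (S.filter fun y => x y < x a).card = L.numNodes
      · rw [if_pos hL, if_pos hL, if_pos (by omega), hL]
        have hB : ((S.erase a).filter fun y => lt y a = false).card = R.numNodes := by omega
        rw [hB]
        have h3 := Nat.choose_mul_factorial_mul_factorial
          (show L.numNodes ≤ n by omega)
        rw [show n - L.numNodes = R.numNodes by omega] at h3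
        have h4 : (n.choose L.numNodes : ℝ) * L.numNodes.factorial * R.numNodes.factorial =
            n.factorial := by exact_mod_cast h3
        rw [← h4]
        ring
      · rw [if_neg hL, if_neg hL]
        ring
    rw [sum_orderings hS, Finset.sum_congr rfl h1, ← Finset.sum_filter, Finset.sum_const,
      card_filter_rank_eq hx (by omega), one_smul, weight, h, Nat.factorial_succ, hn]
    push_cast
    field_simp

end Orderings

/-! ### The law of the shape of a random binary search tree -/

/-- A random tree whose shape has the law of the random binary search tree with `n` nodes. -/
structure HasTreeLaw {Ω : Type*} [MeasurableSpace Ω] (P : Measure Ω) (n : ℕ)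
    (τ : Ω → BinaryTree Unit) : Prop where
  numNodes_eq : ∀ ω, (τ ω).numNodes = n
  measurableSet_eq : ∀ t, MeasurableSet {ω | τ ω = t}
  measure_eq : ∀ t, t.numNodes = n → P {ω | τ ω = t} = ENNReal.ofReal (weight t)

theorem exists_perm_map_finRange {n : ℕ} {l : List (Fin n)}
    (hl : l ∈ orderings (Finset.univ : Finset (Fin n))) :
    ∃ e : Equiv.Perm (Fin n), l = (List.finRange n).map e := by
  have hlen : l.length = n := by rw [length_of_mem_orderings hl, Finset.card_univ, Fintype.card_fin]
  have hnodup : l.Nodup := by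
    rw [← Multiset.coe_nodup, ← mem_orderings.1 hl]
    exact Finset.nodup _
  have hinj : Function.Injective fun i : Fin n => l.get (i.cast hlen.symm) := by
    intro i j hij
    have := hnodup.injective_get hij
    simpa using this
  refine ⟨Equiv.ofBijective _ (Finite.injective_iff_bijective.1 hinj), ?_⟩
  refine List.ext_get (by simp [hlen]) fun k h1 h2 => ?_
  simp

theorem measurable_compare (n : ℕ) :
    Measurable fun (y : Fin n → ℝ) (p : Fin n × Fin n) => decide (y p.1 < y p.2) := by
  refine measurable_pi_lambda _ fun p => ?_
  refine measurable_to_bool ?_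
  have : (fun y : Fin n → ℝ => decide (y p.1 < y p.2)) ⁻¹' {true} = {y | y p.1 < y p.2} := by
    ext y; simp
  rw [this]
  exact measurableSet_lt (measurable_pi_apply _) (measurable_pi_apply _)

theorem measurableSet_treeOf_eq {n : ℕ} (l : List (Fin n)) (t : BinaryTree Unit) :
    MeasurableSet {y : Fin n → ℝ | treeOf (fun i j => decide (y i < y j)) l = t} :=
  measurable_compare n (Set.toFinite {c : Fin n × Fin n → Bool |
    treeOf (fun i j => c (i, j)) l = t}).measurableSet

/-! ### Exchangeability of the uniform input -/

section UniformInput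

variable {Ω : Type*} [MeasurableSpace Ω] {P : Measure Ω} [IsProbabilityMeasure P]

/-- By Fubini: the sections of the diagonal are points, which are null sets for the law of `Y`. -/
theorem measure_eq_eq_zero {X Y : Ω → ℝ} (hX : Measurable X) (hY : Measurable Y)
    (hXY : IndepFun X Y P) (hlaw : ∀ x, P.map Y {x} = 0) : P {ω | X ω = Y ω} = 0 := by
  have h := (indepFun_iff_map_prod_eq_prod_map_map hX.aemeasurable hY.aemeasurable).1 hXY
  have : IsProbabilityMeasure (P.map Y) := Measure.isProbabilityMeasure_map hY.aemeasurable
  have hm : MeasurableSet {p : ℝ × ℝ | p.1 = p.2} := measurableSet_eq_fun measurable_fst measurable_snd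
  have h2 : P {ω | X ω = Y ω} = P.map (fun ω => (X ω, Y ω)) {p | p.1 = p.2} := by
    rw [Measure.map_apply (hX.prodMk hY) hm]
    rfl
  rw [h2, h, Measure.measure_prod_null hm]
  refine Eventually.of_forall fun x => ?_
  have : Prod.mk x ⁻¹' {p : ℝ × ℝ | p.1 = p.2} = {x} := by
    ext y; simp [eq_comm]
  change P.map Y (Prod.mk x ⁻¹' {p : ℝ × ℝ | p.1 = p.2}) = 0
  rw [this, hlaw]

variable {ξ : ℕ → Ω → ℝ}

theorem ae_injective (hξ : ∀ n, Measurable (ξ n)) (hindep : iIndepFun ξ P)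
    (hunif : ∀ n, pdf.IsUniform (ξ n) (Set.Icc (0 : ℝ) 1) P) :
    ∀ᵐ ω ∂P, Function.Injective fun n => ξ n ω := by
  have h : ∀ i j : ℕ, i ≠ j → ∀ᵐ ω ∂P, ξ i ω ≠ ξ j ω := by
    intro i j hij
    rw [ae_iff]
    simp only [ne_eq, not_not]
    refine measure_eq_eq_zero (hξ i) (hξ j) (hindep.indepFun hij) fun x => ?_
    rw [hunif j]
    exact (cond_absolutelyContinuous (μ := volume)) (measure_singleton x)
  have h2 : ∀ᵐ ω ∂P, ∀ i j : ℕ, i ≠ j → ξ i ω ≠ ξ j ω :=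
    ae_all_iff.2 fun i => ae_all_iff.2 fun j => by
      by_cases hij : i = j
      · exact Eventually.of_forall fun ω h => absurd hij h
      · exact (h i j hij).mono fun ω hω _ => hω
  filter_upwards [h2] with ω hω i j hij
  by_contra hne
  exact hω i j hne hij

theorem map_perm_eq (hξ : ∀ n, Measurable (ξ n)) (hindep : iIndepFun ξ P)
    (hunif : ∀ n, pdf.IsUniform (ξ n) (Set.Icc (0 : ℝ) 1) P) {n : ℕ} (e : Equiv.Perm (Fin n)) :
    P.map (fun ω (i : Fin n) => ξ (e i) ω) = P.map (fun ω (i : Fin n) => ξ i ω) := by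
  have h : ∀ e : Equiv.Perm (Fin n), P.map (fun ω (i : Fin n) => ξ (e i) ω) =
      Measure.pi fun _ : Fin n => ProbabilityTheory.cond volume (Set.Icc (0 : ℝ) 1) := by
    intro e
    have h1 : iIndepFun (fun i : Fin n => ξ (e i)) P :=
      hindep.precomp (g := fun i : Fin n => ((e i : Fin n) : ℕ))
        (Fin.val_injective.comp e.injective)
    rw [(iIndepFun_iff_map_fun_eq_pi_map fun i => (hξ _).aemeasurable).1 h1]
    congr 1
    funext i
    exact hunif _
  rw [h e]
  exact (h (Equiv.refl _)).symm

/-- By exchangeability, reading the keys in any order yields the shape `t` with the same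
probability. Almost surely the keys are distinct and exactly `n! * weight t` of the `n!` orders
yield `t`, so integrating this count determines the probability. -/
theorem hasTreeLaw_shape_labeledBST (hξ : ∀ n, Measurable (ξ n)) (hindep : iIndepFun ξ P)
    (hunif : ∀ n, pdf.IsUniform (ξ n) (Set.Icc (0 : ℝ) 1) P) (n : ℕ) :
    HasTreeLaw P n fun ω => (labeledBST (fun k => ξ k ω) n).shape := by
  have hX : Measurable fun ω (i : Fin n) => ξ i ω := measurable_pi_lambda _ fun i => hξ i
  have hmeas : ∀ (l : List (Fin n)) (t : BinaryTree Unit), MeasurableSet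
      {ω | treeOf (fun i j : Fin n => decide (ξ i ω < ξ j ω)) l = t} := fun l t =>
    hX (measurableSet_treeOf_eq l t)
  refine ⟨fun ω => ?_, fun t => ?_, fun t ht => ?_⟩
  · rw [shape_labeledBST, numNodes_treeOf, List.length_finRange]
  · simp_rw [shape_labeledBST]
    exact hmeas _ t
  simp_rw [shape_labeledBST]
  set E : List (Fin n) → Set Ω := fun l =>
    {ω | treeOf (fun i j : Fin n => decide (ξ i ω < ξ j ω)) l = t} with hE
  have hsame : ∀ l ∈ orderings (Finset.univ : Finset (Fin n)),
      P.real (E l) = P.real (E (List.finRange n)) := by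
    intro l hl
    obtain ⟨e, rfl⟩ := exists_perm_map_finRange hl
    have hXe : Measurable fun ω (i : Fin n) => ξ (e i) ω := measurable_pi_lambda _ fun i => hξ _
    have h1 : E ((List.finRange n).map e) = (fun ω (i : Fin n) => ξ (e i) ω) ⁻¹'
        {y | treeOf (fun i j => decide (y i < y j)) (List.finRange n) = t} := by
      ext ω
      simp only [hE, treeOf_map]
      rfl
    have h2 : E (List.finRange n) = (fun ω (i : Fin n) => ξ i ω) ⁻¹'
        {y | treeOf (fun i j => decide (y i < y j)) (List.finRange n) = t} := rfl
    rw [measureReal_def, measureReal_def, h1, h2,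
      ← Measure.map_apply hXe (measurableSet_treeOf_eq _ t),
      ← Measure.map_apply hX (measurableSet_treeOf_eq _ t), map_perm_eq hξ hindep hunif]
  have hcount : ∀ᵐ ω ∂P, ∑ l ∈ orderings (Finset.univ : Finset (Fin n)),
      (E l).indicator (fun _ => (1 : ℝ)) ω = n.factorial * weight t := by
    filter_upwards [ae_injective hξ hindep hunif] with ω hω
    have h := card_orderings_treeOf_eq t (S := (Finset.univ : Finset (Fin n)))
      (x := fun i : Fin n => ξ i ω) ((hω.comp Fin.val_injective).injOn)
    rw [Finset.card_univ, Fintype.card_fin, if_pos ht.symm] at h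
    rw [← h]
    refine Finset.sum_congr rfl fun l _ => ?_
    simp [hE, Set.indicator_apply]
  have hsum : ∑ l ∈ orderings (Finset.univ : Finset (Fin n)), P.real (E l) =
      n.factorial * weight t := by
    have h1 : ∫ ω, ∑ l ∈ orderings (Finset.univ : Finset (Fin n)),
        (E l).indicator (fun _ => (1 : ℝ)) ω ∂P = n.factorial * weight t := by
      rw [integral_congr_ae hcount]
      simp
    rw [integral_finsetSum _ fun l _ => (integrable_const (1 : ℝ)).indicator (hmeas l t)] at h1
    rw [← h1]
    refine Finset.sum_congr rfl fun l _ => ?_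
    rw [integral_indicator (hmeas l t)]
    simp [hE]
  rw [Finset.sum_congr rfl hsame, Finset.sum_const, nsmul_eq_mul, card_orderings,
    Finset.card_univ, Fintype.card_fin] at hsum
  have hfac : (n.factorial : ℝ) ≠ 0 := by positivity
  rw [← mul_left_cancel₀ hfac hsum, measureReal_def, ENNReal.ofReal_toReal (measure_ne_top _ _)]

end UniformInput

/-! ### Consequences of the law of the shape -/

section TreeLaw

variable {Ω : Type*} [MeasurableSpace Ω] {P : Measure Ω} {n : ℕ} {τ : Ω → BinaryTree Unit}

theorem HasTreeLaw.setOf_eq (h : HasTreeLaw P n τ) (p : BinaryTree Unit → Prop) [DecidablePred p] :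
    {ω | p (τ ω)} =
      ⋃ t ∈ (BinaryTree.treesOfNumNodesEq n).filter p, {ω | τ ω = t} := by
  ext ω
  simp [BinaryTree.mem_treesOfNumNodesEq, h.numNodes_eq]

theorem HasTreeLaw.measurableSet (h : HasTreeLaw P n τ) (p : BinaryTree Unit → Prop) :
    MeasurableSet {ω | p (τ ω)} := by
  classical
  rw [h.setOf_eq]
  exact Finset.measurableSet_biUnion _ fun t _ => h.measurableSet_eq t

theorem HasTreeLaw.measurable {E : Type*} [MeasurableSpace E] (h : HasTreeLaw P n τ)
    (g : BinaryTree Unit → E) : Measurable fun ω => g (τ ω) :=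
  fun s _ => h.measurableSet fun t => g t ∈ s

theorem HasTreeLaw.measure_setOf (h : HasTreeLaw P n τ) (p : BinaryTree Unit → Prop)
    [DecidablePred p] :
    P {ω | p (τ ω)} = ENNReal.ofReal (treeMean n fun t => if p t then 1 else 0) := by
  rw [h.setOf_eq, measure_biUnion_finset]
  · rw [treeMean, ENNReal.ofReal_sum_of_nonneg fun t _ => mul_nonneg (weight_nonneg t)
      (by split_ifs <;> norm_num), Finset.sum_filter]
    refine Finset.sum_congr rfl fun t ht => ?_
    split_ifs
    · rw [h.measure_eq t (BinaryTree.mem_treesOfNumNodesEq.1 ht), mul_one]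
    · simp
  · intro s _ t _ hst
    rw [Function.onFun, Set.disjoint_left]
    intro ω hs ht
    exact hst (hs.symm.trans ht)
  · exact fun t _ => h.measurableSet_eq t

theorem HasTreeLaw.measure_le_div (h : HasTreeLaw P n τ) {f : BinaryTree Unit → ℝ}
    (hf : ∀ t, 0 ≤ f t) {c B : ℝ} (hc : 0 < c) (hB : treeMean n f ≤ B) :
    P {ω | c ≤ f (τ ω)} ≤ ENNReal.ofReal (B / c) := by
  classical
  rw [h.measure_setOf fun t => c ≤ f t]
  refine ENNReal.ofReal_le_ofReal ?_
  rw [le_div_iff₀ hc, ← treeMean_mul_const]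
  refine (treeMean_mono fun t _ => ?_).trans hB
  split_ifs with h
  · rwa [one_mul]
  · rw [zero_mul]; exact hf t

theorem HasTreeLaw.map_eq {Ω' : Type*} [MeasurableSpace Ω'] {P' : Measure Ω'}
    {τ' : Ω' → BinaryTree Unit} (h : HasTreeLaw P n τ) (h' : HasTreeLaw P' n τ') {E : Type*}
    [MeasurableSpace E] (g : BinaryTree Unit → E) :
    P.map (fun ω => g (τ ω)) = P'.map (fun ω => g (τ' ω)) := by
  classical
  ext s hs
  rw [Measure.map_apply (h.measurable g) hs, Measure.map_apply (h'.measurable g) hs]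
  exact (h.measure_setOf fun t => g t ∈ s).trans (h'.measure_setOf fun t => g t ∈ s).symm

end TreeLaw

/-! ### A coupling of the random trees of all sizes -/

/-- The uniform distribution on the unit interval. -/
def unif : Measure ℝ := volume.restrict (Set.Ioo 0 1)

instance : IsProbabilityMeasure unif := ⟨by simp [unif]⟩

/-- The product of uniform distributions over all nodes of the infinite binary tree. -/
def fieldMeasure : Measure (List Bool → ℝ) := Measure.infinitePi fun _ => unif

instance : IsProbabilityMeasure fieldMeasure := by
  rw [fieldMeasure]; infer_instance

/-- The value of a field at the root together with the fields on both subtrees make up a field. -/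
def glue (p : ℝ × (List Bool → ℝ) × (List Bool → ℝ)) : List Bool → ℝ
  | [] => p.1
  | b :: w => if b then p.2.2 w else p.2.1 w

theorem measurable_glue : Measurable glue := by
  refine measurable_pi_lambda _ fun v => ?_
  rcases v with _ | ⟨b, w⟩
  · exact measurable_fst
  · cases b
    · exact (measurable_pi_apply w).comp (measurable_fst.comp measurable_snd)
    · exact (measurable_pi_apply w).comp (measurable_snd.comp measurable_snd)

/-- Self-similarity of the field, checked on finite-dimensional rectangles by sorting the words into
the empty one and those starting with each letter. -/
theorem map_glue : (unif.prod (fieldMeasure.prod fieldMeasure)).map glue = fieldMeasure := by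
  refine Measure.eq_infinitePi _ fun s t ht => ?_
  have hs : ∀ b : Bool, Set.InjOn (List.cons b) (List.cons b ⁻¹' (s : Set (List Bool))) :=
    fun b => List.cons_injective.injOn
  set sb : Bool → Finset (List Bool) := fun b => s.preimage (List.cons b) (hs b) with hsb
  have hpre : glue ⁻¹' ((s : Set (List Bool)).pi t) =
      (if [] ∈ s then t [] else Set.univ) ×ˢ
        (((sb false : Set (List Bool)).pi fun w => t (false :: w)) ×ˢ
          ((sb true : Set (List Bool)).pi fun w => t (true :: w))) := by
    ext ⟨x, V, W⟩
    simp only [Set.mem_preimage, Set.mem_pi, Set.mem_prod, Finset.mem_coe, hsb, Finset.mem_preimage]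
    constructor
    · intro h
      refine ⟨?_, fun w hw => h _ hw, fun w hw => h _ hw⟩
      split_ifs with h0
      · exact h [] h0
      · trivial
    · rintro ⟨h1, h2, h3⟩ (_ | ⟨_ | _, w⟩) hv
      · rwa [if_pos hv] at h1
      · exact h2 w hv
      · exact h3 w hv
  have hm : MeasurableSet ((s : Set (List Bool)).pi t) :=
    MeasurableSet.pi s.countable_toSet fun i _ => ht i
  have hsplit : s = (if [] ∈ s then {[]} else ∅) ∪
      ((sb false).map ⟨List.cons false, List.cons_injective⟩ ∪
        (sb true).map ⟨List.cons true, List.cons_injective⟩) := by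
    ext v
    rcases v with _ | ⟨_ | _, w⟩
    · by_cases h : [] ∈ s <;> simp [h]
    · by_cases h : [] ∈ s <;> simp [h, hsb]
    · by_cases h : [] ∈ s <;> simp [h, hsb]
  rw [Measure.map_apply measurable_glue hm, hpre, Measure.prod_prod, Measure.prod_prod,
    fieldMeasure, Measure.infinitePi_pi _ fun w _ => ht _,
    Measure.infinitePi_pi _ fun w _ => ht _]
  conv_rhs => rw [hsplit]
  rw [Finset.prod_union, Finset.prod_union, Finset.prod_map, Finset.prod_map]
  · congr 1
    split_ifs <;> simp
  · rw [Finset.disjoint_left]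
    intro v hv hv'
    simp only [Finset.mem_map, Function.Embedding.coeFn_mk] at hv hv'
    obtain ⟨w, _, rfl⟩ := hv
    obtain ⟨w', _, h⟩ := hv'
    simp at h
  · rw [Finset.disjoint_left]
    intro v hv hv'
    have : v = [] := by
      split_ifs at hv
      · exact Finset.mem_singleton.1 hv
      · simp at hv
    subst this
    exact absurd hv' (by simp)

/-- The size of the left subtree of a tree with `n + 1` nodes, as a function of a uniform
variable. -/
def split (n : ℕ) (u : ℝ) : ℕ := min ⌊((n : ℝ) + 1) * u⌋₊ n

theorem split_le (n : ℕ) (u : ℝ) : split n u ≤ n := min_le_right _ _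

theorem measurable_split (n : ℕ) : Measurable (split n) :=
  (Nat.measurable_floor.comp (measurable_const_mul _)).min measurable_const

theorem split_eq_floor {u : ℝ} (hu : u ∈ Set.Ioo (0 : ℝ) 1) (n : ℕ) :
    split n u = ⌊((n : ℝ) + 1) * u⌋₊ := by
  refine min_eq_left (Nat.lt_succ_iff.1 ((Nat.floor_lt (by have := hu.1; positivity)).2 ?_))
  push_cast
  have : (0 : ℝ) < n + 1 := by positivity
  nlinarith [hu.2]

/-- The preimage of `i` lies between the open and the half-open interval with endpoints `i / (n +
1)` and `(i + 1) / (n + 1)`, so the left size is uniform on `0, …, n`. -/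
theorem unif_split_eq {n i : ℕ} (hi : i ≤ n) :
    unif {u | split n u = i} = ENNReal.ofReal (1 / ((n : ℝ) + 1)) := by
  have hn : (0 : ℝ) < n + 1 := by positivity
  have hi' : (i : ℝ) ≤ n := by exact_mod_cast hi
  have hm : MeasurableSet {u | split n u = i} := measurable_split n (measurableSet_singleton i)
  have hlen : ((i : ℝ) + 1) / (n + 1) - i / (n + 1) = 1 / (n + 1) := by ring
  have hset : ∀ u ∈ Set.Ioo (0 : ℝ) 1,
      split n u = i ↔ (i : ℝ) / (n + 1) ≤ u ∧ u < ((i : ℝ) + 1) / (n + 1) := by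
    intro u hu
    rw [split_eq_floor hu, Nat.floor_eq_iff (by have := hu.1; positivity), div_le_iff₀ hn,
      lt_div_iff₀ hn, mul_comm u]
  rw [unif, Measure.restrict_apply hm]
  refine le_antisymm ?_ ?_
  · rw [← hlen, ← Real.volume_Ico]
    exact measure_mono fun u hu => (hset u hu.2).1 hu.1
  · rw [← hlen, ← Real.volume_Ioo]
    refine measure_mono fun u hu => ?_
    have hu0 : u ∈ Set.Ioo (0 : ℝ) 1 := by
      refine ⟨lt_of_le_of_lt (by positivity) hu.1, hu.2.trans_le ?_⟩
      rw [div_le_one hn]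
      linarith
    exact ⟨(hset u hu0).2 ⟨hu.1.le, hu.2⟩, hu0⟩

/-- The tree with `n` nodes that is generated by a field of splitting variables. -/
def coupled : ℕ → (List Bool → ℝ) → BinaryTree Unit
  | 0, _ => .nil
  | n + 1, U => .node () (coupled (split n (U [])) fun w => U (false :: w))
      (coupled (n - split n (U [])) fun w => U (true :: w))
termination_by n => n
decreasing_by
  · exact Nat.lt_succ_of_le (split_le _ _)
  · exact Nat.lt_succ_of_le (Nat.sub_le _ _)

theorem numNodes_coupled (n : ℕ) (U : List Bool → ℝ) : (coupled n U).numNodes = n := by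
  induction n using Nat.strong_induction_on generalizing U with
  | _ n ih =>
    cases n with
    | zero => rw [coupled, BinaryTree.numNodes]
    | succ n =>
      have := split_le n (U [])
      rw [coupled, BinaryTree.numNodes, ih _ (by omega), ih _ (by omega)]
      omega

theorem coupled_succ_eq_iff {n : ℕ} {l r : BinaryTree Unit} (h : l.numNodes + r.numNodes = n)
    (U : List Bool → ℝ) : coupled (n + 1) U = .node () l r ↔
      split n (U []) = l.numNodes ∧ coupled l.numNodes (fun w => U (false :: w)) = l ∧
        coupled r.numNodes (fun w => U (true :: w)) = r := by
  rw [coupled, BinaryTree.node.injEq]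
  constructor
  · rintro ⟨-, h1, h2⟩
    have h3 : split n (U []) = l.numNodes := by rw [← h1, numNodes_coupled]
    have h4 : n - split n (U []) = r.numNodes := by rw [← h2, numNodes_coupled]
    rw [h3] at h1
    rw [h4] at h2
    exact ⟨h3, h1, h2⟩
  · rintro ⟨h1, h2, h3⟩
    have h4 : n - split n (U []) = r.numNodes := by omega
    rw [h4, h1]
    exact ⟨rfl, h2, h3⟩

theorem measurableSet_coupled_eq (t : BinaryTree Unit) :
    MeasurableSet {U | coupled t.numNodes U = t} := by
  induction t with
  | nil => simp [coupled, BinaryTree.numNodes]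
  | node u l r ihl ihr =>
    have : {U | coupled (BinaryTree.node u l r).numNodes U = .node u l r} =
        {U | split (l.numNodes + r.numNodes) (U []) = l.numNodes} ∩
        ((fun U w => U (false :: w)) ⁻¹' {V | coupled l.numNodes V = l} ∩
          (fun U w => U (true :: w)) ⁻¹' {W | coupled r.numNodes W = r}) := by
      ext U
      rw [BinaryTree.numNodes]
      exact coupled_succ_eq_iff rfl U
    rw [this]
    refine MeasurableSet.inter ?_ (MeasurableSet.inter ?_ ?_)
    · exact ((measurable_split _).comp (measurable_pi_apply _)) (measurableSet_singleton _)
    · exact (measurable_pi_lambda _ fun w => measurable_pi_apply _) ihl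
    · exact (measurable_pi_lambda _ fun w => measurable_pi_apply _) ihr

/-- Induction through `map_glue`: splitting variable and subfields are independent, and the split
has probability `1 / (n + 1)`. -/
theorem fieldMeasure_coupled_eq (t : BinaryTree Unit) :
    fieldMeasure {U | coupled t.numNodes U = t} = ENNReal.ofReal (weight t) := by
  induction t with
  | nil => simp [coupled, BinaryTree.numNodes, weight]
  | node u l r ihl ihr =>
    rw [← map_glue, Measure.map_apply measurable_glue (measurableSet_coupled_eq _)]
    have : glue ⁻¹' {U | coupled (BinaryTree.node u l r).numNodes U = .node u l r} =
        {u | split (l.numNodes + r.numNodes) u = l.numNodes} ×ˢ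
        ({V | coupled l.numNodes V = l} ×ˢ {W | coupled r.numNodes W = r}) := by
      ext ⟨x, V, W⟩
      rw [BinaryTree.numNodes]
      exact coupled_succ_eq_iff rfl _
    rw [this, Measure.prod_prod, Measure.prod_prod, ihl, ihr,
      unif_split_eq (Nat.le_add_right _ _), ← ENNReal.ofReal_mul (weight_nonneg l),
      ← ENNReal.ofReal_mul (by positivity), weight]
    congr 1
    push_cast
    ring

theorem hasTreeLaw_coupled (n : ℕ) : HasTreeLaw fieldMeasure n (coupled n) where
  numNodes_eq := numNodes_coupled n
  measurableSet_eq t := by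
    by_cases h : t.numNodes = n
    · rw [← h]
      exact measurableSet_coupled_eq t
    · have : {U | coupled n U = t} = ∅ := by
        ext U
        simp only [Set.mem_ofPred_eq, Set.mem_empty_iff_false, iff_false]
        rintro rfl
        exact h (numNodes_coupled n U)
      rw [this]
      exact MeasurableSet.empty
  measure_eq t ht := by
    rw [← ht]
    exact fieldMeasure_coupled_eq t

/-! ### Sequences that are Cauchy in measure -/

section CauchyInMeasure

variable {Ω E : Type*} [MeasurableSpace Ω] [MetricSpace E]

/-- The sequence `f` is a Cauchy sequence for convergence in measure. -/
def CauchyInMeasure (μ : Measure Ω) (f : ℕ → Ω → E) : Prop :=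
  ∀ ε : ℝ, 0 < ε → Tendsto (fun p : ℕ × ℕ => μ {ω | ε ≤ dist (f p.1 ω) (f p.2 ω)}) atTop (𝓝 0)

theorem measure_le_dist_le (μ : Measure Ω) (f g h : Ω → E) (ε : ℝ) :
    μ {ω | ε ≤ dist (f ω) (h ω)} ≤
      μ {ω | ε / 2 ≤ dist (f ω) (g ω)} + μ {ω | ε / 2 ≤ dist (g ω) (h ω)} := by
  refine (measure_mono fun ω hω => ?_).trans (measure_union_le _ _)
  by_contra hcon
  simp only [Set.mem_union, Set.mem_ofPred_eq, not_or, not_le] at hcon hω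
  linarith [dist_triangle (f ω) (g ω) (h ω)]

/-- A rapidly Cauchy subsequence converges almost surely by Borel–Cantelli, and the Cauchy property
carries its limit over to the whole sequence. -/
theorem CauchyInMeasure.exists_tendstoInMeasure [CompleteSpace E] [Nonempty E] {μ : Measure Ω}
    [IsFiniteMeasure μ] {f : ℕ → Ω → E} (hf : ∀ n, AEStronglyMeasurable (f n) μ)
    (h : CauchyInMeasure μ f) : ∃ g, TendstoInMeasure μ f atTop g := by
  have hex : ∀ k : ℕ, ∃ N : ℕ, ∀ n ≥ N, ∀ m ≥ N,
      μ {ω | (1 / 2 : ℝ) ^ k ≤ dist (f n ω) (f m ω)} ≤ 2⁻¹ ^ k := by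
    intro k
    have h1 := (ENNReal.tendsto_nhds_zero.1 (h ((1 / 2) ^ k) (by positivity))) (2⁻¹ ^ k)
      (by simp [pos_iff_ne_zero])
    obtain ⟨⟨N, M⟩, hN⟩ := eventually_atTop.1 h1
    exact ⟨max N M, fun n hn m hm => hN (n, m)
      ⟨(le_max_left _ _).trans hn, (le_max_right _ _).trans hm⟩⟩
  choose N hN using hex
  -- Partial sums make the indices monotone and at least `N k`; the added `k` forces them to
  -- infinity.
  set φ : ℕ → ℕ := fun k => ∑ i ∈ Finset.range (k + 1), N i + k with hφ
  have hφN : ∀ k, N k ≤ φ k := fun k =>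
    (Finset.single_le_sum (f := N) (fun _ _ => Nat.zero_le _)
      (Finset.mem_range.2 (Nat.lt_succ_self k))).trans (Nat.le_add_right _ _)
  have hφmono : ∀ k, φ k ≤ φ (k + 1) := fun k => by
    simp only [hφ]
    rw [Finset.sum_range_succ N (k + 1)]
    omega
  have hφtop : Tendsto φ atTop atTop :=
    tendsto_atTop_mono (fun k => Nat.le_add_left k _) tendsto_id
  have hae : ∀ᵐ ω ∂μ, ∃ x, Tendsto (fun k => f (φ k) ω) atTop (𝓝 x) := by
    have h1 : ∑' k, μ {ω | (1 / 2 : ℝ) ^ k ≤ dist (f (φ k) ω) (f (φ (k + 1)) ω)} ≠ ∞ := by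
      refine ne_top_of_le_ne_top ?_ (ENNReal.tsum_le_tsum fun k =>
        hN k _ (hφN k) _ ((hφN k).trans (hφmono k)))
      rw [ENNReal.tsum_geometric]
      simp
    filter_upwards [ae_eventually_notMem h1] with ω hω
    refine cauchySeq_tendsto_of_complete (cauchySeq_of_summable_dist ?_)
    refine Summable.of_norm_bounded_eventually_nat
      (summable_geometric_of_lt_one (r := (1 / 2 : ℝ)) (by norm_num) (by norm_num)) ?_
    filter_upwards [hω] with k hk
    simp only [not_le] at hk
    rw [Real.norm_of_nonneg dist_nonneg]
    exact hk.le
  classical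
  refine ⟨fun ω => if h : ∃ x, Tendsto (fun k => f (φ k) ω) atTop (𝓝 x) then h.choose
    else Classical.arbitrary E, ?_⟩
  set g : Ω → E := fun ω => if h : ∃ x, Tendsto (fun k => f (φ k) ω) atTop (𝓝 x) then h.choose
    else Classical.arbitrary E with hg
  have hsub : TendstoInMeasure μ (fun k => f (φ k)) atTop g := by
    refine tendstoInMeasure_of_tendsto_ae (fun k => hf _) ?_
    filter_upwards [hae] with ω hω
    simp only [hg, dif_pos hω]
    exact hω.choose_spec
  rw [tendstoInMeasure_iff_dist] at hsub ⊢
  intro ε hε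
  rw [ENNReal.tendsto_nhds_zero]
  intro δ hδ
  have hδ2 : 0 < δ / 2 := ENNReal.half_pos hδ.ne'
  obtain ⟨⟨K, L⟩, hKL⟩ := eventually_atTop.1
    (ENNReal.tendsto_nhds_zero.1 (h (ε / 2) (by positivity)) (δ / 2) hδ2)
  obtain ⟨k, hk1, hk2⟩ := ((ENNReal.tendsto_nhds_zero.1 (hsub (ε / 2) (by positivity)) (δ / 2)
    hδ2).and (hφtop.eventually_ge_atTop L)).exists
  filter_upwards [eventually_ge_atTop K] with n hn
  refine (measure_le_dist_le μ (f n) (f (φ k)) g ε).trans ?_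
  exact (add_le_add (hKL (n, φ k) ⟨hn, hk2⟩) hk1).trans_eq (ENNReal.add_halves δ)

end CauchyInMeasure

/-! ### Convergence of the coupled trees -/

/-- Since `harm n - log n` converges, Euler's constant cancels and only `log (a n / (n + 1))`
remains. -/
theorem tendsto_harm_sub {a : ℕ → ℕ} {c : ℝ} (hc : 0 < c)
    (ha : Tendsto (fun n => (a n : ℝ) / (n + 1)) atTop (𝓝 c)) :
    Tendsto a atTop atTop ∧
      Tendsto (fun n => harm (a n) - harm (n + 1)) atTop (𝓝 (Real.log c)) := by
  have hn1 : Tendsto (fun n : ℕ => (n : ℝ) + 1) atTop atTop :=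
    tendsto_atTop_add_const_right _ _ tendsto_natCast_atTop_atTop
  have htop : Tendsto a atTop atTop := by
    rw [← tendsto_natCast_atTop_iff (R := ℝ)]
    refine (ha.pos_mul_atTop hc hn1).congr fun n => ?_
    field_simp
  refine ⟨htop, ?_⟩
  have h0 : Tendsto (fun n : ℕ => harm n - Real.log n) atTop (𝓝 Real.eulerMascheroniConstant) :=
    Real.tendsto_harmonic_sub_log
  have h1 := h0.comp htop
  have h2 := h0.comp (tendsto_add_atTop_nat 1)
  have h3 := (Real.continuousAt_log hc.ne').tendsto.comp ha
  have h4 := (h1.sub h2).add h3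
  rw [sub_self, zero_add] at h4
  refine h4.congr' ?_
  filter_upwards [htop.eventually_gt_atTop 0] with n hn
  have : (a n : ℝ) ≠ 0 := by positivity
  simp only [Function.comp_apply]
  rw [Real.log_div this (by positivity)]
  push_cast
  ring

theorem tendsto_split {u : ℝ} (hu : u ∈ Set.Ioo (0 : ℝ) 1) :
    Tendsto (fun n => (split n u : ℝ) / (n + 1)) atTop (𝓝 u) := by
  have hn1 : Tendsto (fun n : ℕ => (n : ℝ) + 1) atTop atTop :=
    tendsto_atTop_add_const_right _ _ tendsto_natCast_atTop_atTop
  refine ((tendsto_nat_floor_mul_div_atTop (R := ℝ) hu.1.le).comp hn1).congr fun n => ?_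
  rw [split_eq_floor hu, Function.comp_apply, mul_comm]

theorem tendsto_sub_split {u : ℝ} (hu : u ∈ Set.Ioo (0 : ℝ) 1) :
    Tendsto (fun n => ((n - split n u : ℕ) : ℝ) / (n + 1)) atTop (𝓝 (1 - u)) := by
  have h := ((tendsto_natCast_div_add_atTop (1 : ℝ)).sub (tendsto_split hu))
  refine h.congr fun n => ?_
  rw [Nat.cast_sub (split_le n u), sub_div]

/-- The part of a field that belongs to the subtree on the side `b` of the root. -/
def subfield (b : Bool) (U : List Bool → ℝ) : List Bool → ℝ := fun w => U (b :: w)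

/-- The size of the subtree on the side `b` of the root of a coupled tree. -/
def splitSize (b : Bool) (n : ℕ) (u : ℝ) : ℕ := if b then n - split n u else split n u

theorem coupled_succ (n : ℕ) (U : List Bool → ℝ) : coupled (n + 1) U =
    .node () (coupled (splitSize false n (U [])) (subfield false U))
      (coupled (splitSize true n (U [])) (subfield true U)) := by
  rw [coupled]
  rfl

theorem splitSize_add (n : ℕ) (u : ℝ) : splitSize false n u + splitSize true n u = n := by
  have := split_le n u
  simp only [splitSize, Bool.false_eq_true, if_false, if_true]
  omega

theorem exists_tendsto_splitSize {u : ℝ} (hu : u ∈ Set.Ioo (0 : ℝ) 1) (b : Bool) :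
    Tendsto (fun n => splitSize b n u) atTop atTop ∧
      ∃ x, Tendsto (fun n => harm (splitSize b n u) - harm (n + 1)) atTop (𝓝 x) := by
  cases b
  · have h := tendsto_harm_sub hu.1 (tendsto_split hu)
    exact ⟨h.1, _, h.2⟩
  · have h := tendsto_harm_sub (sub_pos.2 hu.2) (tendsto_sub_split hu)
    exact ⟨h.1, _, h.2⟩

/-- The difference collects the tolls of the first `k` levels only; each converges because the
relative subtree sizes converge to nonzero limits determined by the field. -/
theorem exists_tendsto_zeta_sub_tail (k : ℕ) {U : List Bool → ℝ}
    (hU : ∀ w, U w ∈ Set.Ioo (0 : ℝ) 1) :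
    ∃ x, Tendsto (fun n => zeta (coupled n U) - tail k (coupled n U)) atTop (𝓝 x) := by
  induction k generalizing U with
  | zero => exact ⟨0, by simp [tail]⟩
  | succ k ih =>
    obtain ⟨h0, y0, hy0⟩ := exists_tendsto_splitSize (hU []) false
    obtain ⟨h1, y1, hy1⟩ := exists_tendsto_splitSize (hU []) true
    obtain ⟨x0, hx0⟩ := ih (U := subfield false U) fun w => hU _
    obtain ⟨x1, hx1⟩ := ih (U := subfield true U) fun w => hU _
    refine ⟨1 + (y0 + y1) / 2 + (x0 + x1) / 2, (tendsto_add_atTop_iff_nat 1).1 ?_⟩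
    refine (((hy0.add hy1).div_const 2).const_add 1 |>.add
      (((hx0.comp h0).add (hx1.comp h1)).div_const 2)).congr fun n => ?_
    simp only [Function.comp_apply]
    rw [coupled_succ, zeta, tail, numNodes_coupled, numNodes_coupled, toll, splitSize_add]
    ring

theorem exists_tendsto_incr_sub_incrTail (k : ℕ) (v : List Bool) {U : List Bool → ℝ}
    (hU : ∀ w, U w ∈ Set.Ioo (0 : ℝ) 1) :
    ∃ x, Tendsto (fun n => incr v (coupled n U) - incrTail k v (coupled n U)) atTop (𝓝 x) := by
  induction v generalizing U with
  | nil => exact exists_tendsto_zeta_sub_tail k hU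
  | cons b w ih =>
    obtain ⟨h, y, hy⟩ := exists_tendsto_splitSize (hU []) b
    obtain ⟨x, hx⟩ := ih (U := subfield b U) fun w => hU _
    refine ⟨x + (1 + y), (tendsto_add_atTop_iff_nat 1).1 ?_⟩
    refine ((hx.comp h).add (hy.const_add 1)).congr fun n => ?_
    have hchild : child b (coupled (splitSize false n (U [])) (subfield false U))
        (coupled (splitSize true n (U [])) (subfield true U)) =
        coupled (splitSize b n (U [])) (subfield b U) := by cases b <;> rfl
    simp only [Function.comp_apply]
    rw [coupled_succ, incr, incrTail, slope, hchild, numNodes_coupled, numNodes_coupled,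
      numNodes_coupled, splitSize_add]
    ring

theorem ae_fieldMeasure_mem_Ioo : ∀ᵐ U ∂fieldMeasure, ∀ w, U w ∈ Set.Ioo (0 : ℝ) 1 := by
  refine ae_all_iff.2 fun w => ?_
  have h1 : ∀ᵐ u ∂unif, u ∈ Set.Ioo (0 : ℝ) 1 := ae_restrict_mem measurableSet_Ioo
  have h2 : MeasurePreserving (Function.eval w) fieldMeasure unif :=
    measurePreserving_eval_infinitePi (fun _ => unif) w
  exact h2.quasiMeasurePreserving.ae h1

/-- The truncated part converges almost surely for fixed `k`, and by Chebyshev the remainder is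
small in probability uniformly in `n`. -/
theorem cauchyInMeasure_incr (v : List Bool) :
    CauchyInMeasure fieldMeasure fun n U => incr v (coupled n U) := by
  intro ε hε
  rw [ENNReal.tendsto_nhds_zero]
  intro δ hδ
  have hδ4 : 0 < δ / 2 / 2 := ENNReal.half_pos (ENNReal.half_pos hδ.ne').ne'
  obtain ⟨k, hk⟩ : ∃ k : ℕ,
      ENNReal.ofReal (32 * momentBound / 2 ^ k / (ε / 2 / 2) ^ 2) ≤ δ / 2 / 2 := by
    have h1 : Tendsto (fun k : ℕ => 32 * momentBound / 2 ^ k / (ε / 2 / 2) ^ 2) atTop (𝓝 0) := by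
      have := (tendsto_const_nhds (x := 32 * momentBound)).div_atTop
        (tendsto_pow_atTop_atTop_of_one_lt (one_lt_two (α := ℝ)))
      simpa using this.div_const ((ε / 2 / 2) ^ 2)
    have h2 := ENNReal.tendsto_ofReal h1
    rw [ENNReal.ofReal_zero] at h2
    exact (ENNReal.tendsto_nhds_zero.1 h2 _ hδ4).exists
  set g : ℕ → (List Bool → ℝ) → ℝ := fun n U => incr v (coupled n U) - incrTail k v (coupled n U)
    with hg
  have htail : ∀ n, fieldMeasure {U | ε / 2 / 2 ≤ dist (incr v (coupled n U)) (g n U)} ≤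
      δ / 2 / 2 := by
    intro n
    refine le_trans (measure_mono fun U hU => ?_) (((hasTreeLaw_coupled n).measure_le_div
      (f := fun t => incrTail k v t ^ 2) (c := (ε / 2 / 2) ^ 2) (fun t => sq_nonneg _)
      (by positivity) (treeMean_incrTail_sq_le k v n)).trans hk)
    simp only [Set.mem_ofPred_eq, hg, Real.dist_eq, sub_sub_cancel] at hU ⊢
    rw [← sq_abs (incrTail k v _)]
    exact pow_le_pow_left₀ (by positivity) hU 2
  have hlim : ∃ G, TendstoInMeasure fieldMeasure g atTop G := by
    classical
    refine ⟨fun U => if h : ∀ w, U w ∈ Set.Ioo (0 : ℝ) 1 then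
      (exists_tendsto_incr_sub_incrTail k v h).choose else 0, ?_⟩
    refine tendstoInMeasure_of_tendsto_ae (fun n => ((hasTreeLaw_coupled n).measurable
      fun t => incr v t - incrTail k v t).aestronglyMeasurable) ?_
    filter_upwards [ae_fieldMeasure_mem_Ioo] with U hU
    rw [dif_pos hU]
    exact (exists_tendsto_incr_sub_incrTail k v hU).choose_spec
  obtain ⟨G, hG⟩ := hlim
  rw [tendstoInMeasure_iff_dist] at hG
  have hev := ENNReal.tendsto_nhds_zero.1 (hG (ε / 2 / 2) (by positivity)) _ hδ4
  have hhalf : ∀ᶠ n in atTop,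
      fieldMeasure {U | ε / 2 ≤ dist (incr v (coupled n U)) (G U)} ≤ δ / 2 := by
    filter_upwards [hev] with n hn
    exact (measure_le_dist_le _ _ (g n) _ _).trans
      ((add_le_add (htail n) hn).trans_eq (ENNReal.add_halves _))
  rw [← prod_atTop_atTop_eq]
  filter_upwards [hhalf.prod_mk hhalf] with p hp
  refine (measure_le_dist_le _ _ G _ _).trans ?_
  refine (add_le_add hp.1 ?_).trans_eq (ENNReal.add_halves _)
  simp_rw [dist_comm (G _)]
  exact hp.2

/-! ### Uniform tail bounds and convergence of the full state -/

/-- The words of a given length. -/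
def words (k : ℕ) : Finset (List Bool) := (Finset.univ : Finset (Fin k → Bool)).image List.ofFn

theorem mem_words (v : List Bool) : v ∈ words v.length :=
  Finset.mem_image.2 ⟨v.get, Finset.mem_univ _, List.ofFn_get v⟩

theorem length_of_mem_words {k : ℕ} {v : List Bool} (h : v ∈ words k) : v.length = k := by
  obtain ⟨f, _, rfl⟩ := Finset.mem_image.1 h
  exact List.length_ofFn

theorem card_words_le (k : ℕ) : (words k).card ≤ 2 ^ k :=
  Finset.card_image_le.trans_eq (by simp)

/-- Markov's inequality and a union bound: `2 ^ k` words with moments of order `8 ^ k` against the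
threshold `32 ^ k` leave the summable factor `(1 / 2) ^ k`. -/
theorem HasTreeLaw.measure_notMem_good_le {Ω : Type*} [MeasurableSpace Ω] {P : Measure Ω} {n : ℕ}
    {τ : Ω → BinaryTree Unit} (h : HasTreeLaw P n τ) {M : ℝ} (hM : 0 < M) :
    P {ω | stateOf (τ ω) ∉ good M} ≤ ENNReal.ofReal (2 * momentBound / M) := by
  have hpos := momentBound_pos
  have hsub : {ω | stateOf (τ ω) ∉ good M} ⊆
      ⋃ k : ℕ, ⋃ v ∈ words k, {ω | M * 32 ^ k ≤ Real.exp (|incr v (τ ω)| / 4)} := by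
    intro ω hω
    simp only [good, Set.mem_ofPred_eq, not_forall, not_le, quotient_stateOf] at hω
    obtain ⟨v, hv⟩ := hω
    exact Set.mem_iUnion.2 ⟨v.length, Set.mem_iUnion₂.2 ⟨v, mem_words v, hv.le⟩⟩
  have hk : ∀ k : ℕ, P (⋃ v ∈ words k, {ω | M * 32 ^ k ≤ Real.exp (|incr v (τ ω)| / 4)}) ≤
      ENNReal.ofReal (momentBound / M * (1 / 2) ^ k) := by
    intro k
    refine (measure_biUnion_finset_le _ _).trans ?_
    have h1 : ∀ v ∈ words k, P {ω | M * 32 ^ k ≤ Real.exp (|incr v (τ ω)| / 4)} ≤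
        ENNReal.ofReal (momentBound * 8 ^ k / (M * 32 ^ k)) := by
      intro v hv
      refine h.measure_le_div (f := fun t => Real.exp (|incr v t| / 4)) (c := M * 32 ^ k)
        (fun t => (Real.exp_pos _).le) (by positivity) ?_
      rw [← length_of_mem_words hv]
      exact treeMean_exp_abs_incr_le v n
    refine (Finset.sum_le_sum h1).trans ?_
    rw [Finset.sum_const, ← ENNReal.ofReal_nsmul]
    refine ENNReal.ofReal_le_ofReal ?_
    rw [nsmul_eq_mul]
    have h2 : ((words k).card : ℝ) ≤ 2 ^ k := by exact_mod_cast card_words_le k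
    calc _ ≤ (2 : ℝ) ^ k * (momentBound * 8 ^ k / (M * 32 ^ k)) := by gcongr
      _ = _ := by
        have : (32 : ℝ) ^ k = 2 ^ k * (8 ^ k * 2 ^ k) := by
          rw [← mul_pow, ← mul_pow]; norm_num
        rw [this, one_div_pow]
        field_simp
  refine (measure_mono hsub).trans ((measure_iUnion_le _).trans ?_)
  refine (ENNReal.tsum_le_tsum hk).trans (le_of_eq ?_)
  have hs := summable_geometric_of_lt_one (r := (1 / 2 : ℝ)) (by norm_num) (by norm_num)
  rw [← ENNReal.ofReal_tsum_of_nonneg (fun k => by positivity) (hs.mul_left _), tsum_mul_left,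
    tsum_geometric_of_lt_one (by norm_num) (by norm_num)]
  congr 1
  ring

theorem exists_measure_notMem_good_le {δ : ℝ≥0∞} (hδ : 0 < δ) :
    ∃ M : ℝ, 0 < M ∧ ENNReal.ofReal (2 * momentBound / M) ≤ δ := by
  have h1 : Tendsto (fun M : ℝ => 2 * momentBound / M) atTop (𝓝 0) :=
    tendsto_const_nhds.div_atTop tendsto_id
  have h2 := ENNReal.tendsto_ofReal h1
  rw [ENNReal.ofReal_zero] at h2
  obtain ⟨M, hM, hM'⟩ := ((ENNReal.tendsto_nhds_zero.1 h2 δ hδ).and (eventually_gt_atTop 0)).exists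
  exact ⟨M, hM', hM⟩

theorem cauchyInMeasure_stateOf_coupled :
    CauchyInMeasure fieldMeasure fun n U => stateOf (coupled n U) := by
  intro ε hε
  rw [ENNReal.tendsto_nhds_zero]
  intro δ hδ
  have hδ4 : 0 < δ / 2 / 2 := ENNReal.half_pos (ENNReal.half_pos hδ.ne').ne'
  obtain ⟨M, hM0, hM⟩ := exists_measure_notMem_good_le hδ4
  -- With quotients within `ε / 8` the distance is at most `2 * (ε / 8) + ε / 4 = ε / 2 < ε`.
  obtain ⟨L, hL⟩ := exists_dist_le_of_good M (δ := ε / 4) (by positivity)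
  have hsum : Tendsto (fun p : ℕ × ℕ => ∑ v ∈ insert [] (words L),
      fieldMeasure {U | ε / 8 ≤ dist (incr v (coupled p.1 U)) (incr v (coupled p.2 U))}) atTop
      (𝓝 (∑ v ∈ insert [] (words L), 0)) :=
    tendsto_finsetSum _ fun v _ => cauchyInMeasure_incr v (ε / 8) (by positivity)
  rw [Finset.sum_const_zero] at hsum
  filter_upwards [ENNReal.tendsto_nhds_zero.1 hsum (δ / 2) (ENNReal.half_pos hδ.ne')] with p hp
  have hsub : {U | ε ≤ dist (stateOf (coupled p.1 U)) (stateOf (coupled p.2 U))} ⊆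
      ({U | stateOf (coupled p.1 U) ∉ good M} ∪ {U | stateOf (coupled p.2 U) ∉ good M}) ∪
      ⋃ v ∈ insert [] (words L),
        {U | ε / 8 ≤ dist (incr v (coupled p.1 U)) (incr v (coupled p.2 U))} := by
    intro U hU
    by_contra hcon
    simp only [Set.mem_union, Set.mem_iUnion, Set.mem_ofPred_eq, not_or, not_not, not_exists,
      not_le] at hcon hU
    obtain ⟨⟨h1, h2⟩, h3⟩ := hcon
    have := hL _ h1 _ h2 (ε / 8) fun v hv => by
      rw [quotient_stateOf, quotient_stateOf, ← Real.dist_eq]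
      refine (h3 v ?_).le
      rcases hv with rfl | rfl
      · exact Finset.mem_insert_of_mem (mem_words v)
      · exact Finset.mem_insert_self _ _
    linarith
  calc _ ≤ (δ / 2 / 2 + δ / 2 / 2) + δ / 2 := by
        refine (measure_mono hsub).trans ((measure_union_le _ _).trans (add_le_add
          ((measure_union_le _ _).trans (add_le_add ?_ ?_))
          ((measure_biUnion_finset_le _ _).trans hp)))
        · exact ((hasTreeLaw_coupled _).measure_notMem_good_le hM0).trans hM
        · exact ((hasTreeLaw_coupled _).measure_notMem_good_le hM0).trans hM
    _ = δ := by rw [ENNReal.add_halves, ENNReal.add_halves]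

theorem isClosed_C00 : IsClosed (C00 : Set C(I, ℝ)) := by
  have : (C00 : Set C(I, ℝ)) = {f | f 0 = 0} ∩ {f | f 1 = 0} := rfl
  rw [this]
  exact (isClosed_eq (continuous_eval_const 0) continuous_const).inter
    (isClosed_eq (continuous_eval_const 1) continuous_const)

instance : CompleteSpace C00 := isClosed_C00.completeSpace_coe

/-- The states of the coupled trees converge in distribution. -/
theorem exists_tendstoInDistribution_coupled :
    ∃ g : (List Bool → ℝ) → StateSpace,
      TendstoInDistribution (fun n U => stateOf (coupled n U)) atTop g
        (fun _ => fieldMeasure) fieldMeasure := by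
  have hm : ∀ n, Measurable fun U => stateOf (coupled n U) := fun n =>
    (hasTreeLaw_coupled n).measurable stateOf
  obtain ⟨g, hg⟩ := cauchyInMeasure_stateOf_coupled.exists_tendstoInMeasure
    fun n => (hm n).aestronglyMeasurable
  exact ⟨g, hg.tendstoInDistribution fun n => (hm n).aemeasurable⟩

/-! ### Path properties of the limit -/

section Limit

variable {Ω Ω' : Type*} [MeasurableSpace Ω] {P : Measure Ω} [IsProbabilityMeasure P]
  [MeasurableSpace Ω'] {P' : Measure Ω'} [IsProbabilityMeasure P'] {X : ℕ → Ω → StateSpace}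
  {W : Ω' → StateSpace}

theorem measure_preimage_open_le
    (h : TendstoInDistribution X atTop W (fun _ => P) P') {G : Set StateSpace} (hG : IsOpen G)
    {c : ℝ≥0∞} (hc : ∀ᶠ n in atTop, P (X n ⁻¹' G) ≤ c) : P' (W ⁻¹' G) ≤ c := by
  have h1 := ProbabilityMeasure.le_liminf_measure_open_of_tendsto h.tendsto hG
  simp only [ProbabilityMeasure.coe_mk] at h1
  rw [Measure.map_apply_of_aemeasurable h.aemeasurable_limit hG.measurableSet] at h1
  refine h1.trans (liminf_le_of_frequently_le' (Eventually.frequently ?_))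
  filter_upwards [hc] with n hn
  rwa [Measure.map_apply_of_aemeasurable (h.forall_aemeasurable n) hG.measurableSet]

variable {τ : ℕ → Ω → BinaryTree Unit}

/-- The complement of `good M` is open, so the uniform bound for the trees passes to the limit; it
would be below half of the exceptional probability if that were positive. -/
theorem ae_exists_mem_good (hτ : ∀ n, HasTreeLaw P n (τ n))
    (h : TendstoInDistribution (fun n ω => stateOf (τ n ω)) atTop W (fun _ => P) P') :
    ∀ᵐ ω ∂P', ∃ M, W ω ∈ good M := by
  rw [ae_iff]
  by_contra hne
  obtain ⟨M, hM0, hM⟩ := exists_measure_notMem_good_le (ENNReal.half_pos hne)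
  have h1 := measure_preimage_open_le h (isClosed_good M).isOpen_compl
    (Eventually.of_forall fun n => (hτ n).measure_notMem_good_le hM0)
  have h2 : P' {ω | ¬∃ M, W ω ∈ good M} ≤ P' (W ⁻¹' (good M)ᶜ) :=
    measure_mono fun ω hω hmem => hω ⟨M, hmem⟩
  exact absurd ((h2.trans h1).trans hM)
    (not_le.2 (ENNReal.half_lt_self hne (measure_ne_top _ _)))

/-- If all quotients were at least `-B`, then `minExp m` would stay above a fixed constant at every
level `m`, with probability geometrically small in `m` by Markov's inequality. -/
theorem ae_forall_exists_quotient_lt (hτ : ∀ n, HasTreeLaw P n (τ n))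
    (h : TendstoInDistribution (fun n ω => stateOf (τ n ω)) atTop W (fun _ => P) P') :
    ∀ᵐ ω ∂P', ∀ B : ℝ, ∃ v, quotient v (W ω) < -B := by
  have key : ∀ B : ℕ, ∀ᵐ ω ∂P', ∃ v, quotient v (W ω) < -(B : ℝ) := by
    intro B
    set c := Real.exp (-(B : ℝ) - 1) with hc
    have hbound : ∀ m : ℕ, P' {ω | ¬∃ v, quotient v (W ω) < -(B : ℝ)} ≤
        ENNReal.ofReal (Real.exp 512 * (19 / 20) ^ m / c) := by
      intro m
      -- The slack of `1` together with strict inequalities gives an open set that contains all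
      -- states with quotients at least `-B`.
      set G : Set StateSpace := ⋂ v ∈ words m, {z | -(B : ℝ) - 1 < quotient v z} with hG
      have hopen : IsOpen G := isOpen_biInter_finset fun v _ =>
        isOpen_lt continuous_const (continuous_quotient v)
      have hev : ∀ᶠ n in atTop, P ((fun ω => stateOf (τ n ω)) ⁻¹' G) ≤
          ENNReal.ofReal (Real.exp 512 * (19 / 20) ^ m / c) := by
        filter_upwards [eventually_treeMean_minExp_le m] with n hn
        refine le_trans (measure_mono fun ω hω => ?_) ((hτ n).measure_le_div
          (f := minExp m) (fun t => (minExp_pos m t).le) (Real.exp_pos _) hn)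
        obtain ⟨v, hv, hv'⟩ := exists_exp_incr_eq_minExp m (τ n ω)
        simp only [hG, Set.mem_preimage, Set.mem_iInter, Set.mem_ofPred_eq,
          quotient_stateOf] at hω
        have := hω v (hv ▸ mem_words v)
        rw [Set.mem_ofPred_eq, ← hv', hc]
        exact Real.exp_le_exp.2 this.le
      refine (measure_mono fun ω hω => ?_).trans (measure_preimage_open_le h hopen hev)
      simp only [Set.mem_ofPred_eq, not_exists, not_lt] at hω
      simp only [hG, Set.mem_preimage, Set.mem_iInter, Set.mem_ofPred_eq]
      intro v _
      linarith [hω v]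
    have hlim : Tendsto (fun m : ℕ => ENNReal.ofReal (Real.exp 512 * (19 / 20) ^ m / c)) atTop
        (𝓝 0) := by
      have h1 := ((tendsto_pow_atTop_nhds_zero_of_lt_one (r := (19 / 20 : ℝ)) (by norm_num)
        (by norm_num)).const_mul (Real.exp 512)).div_const c
      have h2 := ENNReal.tendsto_ofReal h1
      simpa using h2
    rw [ae_iff]
    exact nonpos_iff_eq_zero.1 (ge_of_tendsto' hlim hbound)
  filter_upwards [ae_all_iff.2 key] with ω hω B
  obtain ⟨n, hn⟩ := exists_nat_ge B
  obtain ⟨v, hv⟩ := hω n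
  exact ⟨v, by linarith⟩

end Limit

/-- Convergence in distribution depends only on the individual laws, so the limit of the coupled
trees serves for every sequence of trees with the same laws. -/
theorem exists_tendstoInDistribution {Ω : Type*} [MeasurableSpace Ω] {P : Measure Ω}
    [IsProbabilityMeasure P] {τ : ℕ → Ω → BinaryTree Unit} (hτ : ∀ n, HasTreeLaw P n (τ n)) :
    ∃ (μ : Measure StateSpace) (_ : IsProbabilityMeasure μ),
      TendstoInDistribution (fun n ω => stateOf (τ n ω)) atTop id (fun _ => P) μ := by
  obtain ⟨g, hg⟩ := exists_tendstoInDistribution_coupled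
  have hμ : IsProbabilityMeasure (fieldMeasure.map g) :=
    Measure.isProbabilityMeasure_map hg.aemeasurable_limit
  refine ⟨fieldMeasure.map g, hμ, fun n => ((hτ n).measurable stateOf).aemeasurable,
    aemeasurable_id, ?_⟩
  have h1 := hg.tendsto
  have h2 : (⟨(fieldMeasure.map g).map id, Measure.isProbabilityMeasure_map aemeasurable_id⟩ :
      ProbabilityMeasure StateSpace) = ⟨fieldMeasure.map g, hμ⟩ := Subtype.ext Measure.map_id
  rw [h2]
  refine h1.congr fun n => Subtype.ext ?_
  exact (hasTreeLaw_coupled n).map_eq (hτ n) stateOf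

end Silhouette

end

theorem theorem9 {Ω : Type*} [MeasurableSpace Ω] (P : Measure Ω) [IsProbabilityMeasure P]
    (ξ : ℕ → Ω → ℝ) (hξ : ∀ n, Measurable (ξ n)) (hindep : iIndepFun ξ P)
    (hunif : ∀ n, pdf.IsUniform (ξ n) (Set.Icc (0 : ℝ) 1) P) :
    -- the limit `Z_∞` exists: the sequence `Z_n` converges in distribution
    (∃ (μ : Measure Silhouette.StateSpace) (_ : IsProbabilityMeasure μ),
      TendstoInDistribution (fun n ω => Silhouette.Z (fun k => ξ k ω) n) atTop id
        (fun _ => P) μ) ∧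
    -- path properties of the first component of every version of `Z_∞ = (Y_∞, ζ)`
    ∀ (Ω' : Type*) [MeasurableSpace Ω'] (P' : Measure Ω') [IsProbabilityMeasure P']
      (Yinf : Ω' → Silhouette.C00) (ζ : Ω' → ℝ),
      TendstoInDistribution (fun n ω => Silhouette.Z (fun k => ξ k ω) n) atTop
        (fun ω => (Yinf ω, ζ ω)) (fun _ => P) P' →
      (∀ᵐ ω ∂P', Silhouette.holderSup 1 (Yinf ω) = ∞) ∧
      ∀ α : ℝ, α < 1 → ∀ᵐ ω ∂P', Silhouette.holderSup α (Yinf ω) < ∞ := by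
  have hτ := fun n => Silhouette.hasTreeLaw_shape_labeledBST hξ hindep hunif n
  have hZ : (fun n ω => Silhouette.Z (fun k => ξ k ω) n) =
      fun n ω => Silhouette.stateOf (Silhouette.labeledBST (fun k => ξ k ω) n).shape := by
    funext n ω
    exact Silhouette.Z_eq_stateOf _ n
  rw [hZ]
  refine ⟨Silhouette.exists_tendstoInDistribution hτ, ?_⟩
  intro Ω' _ P' _ Yinf ζ h
  constructor
  · filter_upwards [Silhouette.ae_forall_exists_quotient_lt hτ h] with ω hω
    exact Silhouette.holderSup_one_eq_top (z := (Yinf ω, ζ ω)) hω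
  · intro α hα
    filter_upwards [Silhouette.ae_exists_mem_good hτ h] with ω ⟨M, hM⟩
    exact Silhouette.holderSup_lt_top_of_mem_good (z := (Yinf ω, ζ ω)) hM hα
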